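/- Notation. For a symmetric matrix $Z\in\mathbb R^{r\times r}$, $r\ge1$, let $E$ be the all-ones matrix, $\langle Z,Y\rangle=\sum_{i,j}Z_{ij}Y_{ij}$, and $$\vartheta(Z)=\min\{\langle Z,Y\rangle:\ \langle E,Y\rangle=1,\ Y\succeq0,\ Y\ge0\text{ entrywise}\},\qquad \mu(Z)=\min\{x^\top Zx:\ x\in\mathbb R^r_+,\ \mathbf 1^\top x=1\}.$$ The minimizers $Y$ of the first (doubly nonnegative, DNN) program are called the DNN optimizers of $Z$. A nonempty index set $S$ is called admissible for $Z$ if $|S|=1$, or if $|S|\ge2$, the matrix $K_S=\begin{pmatrix}Z[S]&-\mathbf 1\\ \mathbf 1^\top&0\end{pmatrix}$ is invertible, the unique solution $(x_S,\lambda_S)$ of $Z[S]x=\lambda\mathbf 1$, $\mathbf 1^\top x=1$ has $x_S>0$ entrywise, and $u^\top Z[S]u>0$ for all $u\ne0$ with $\mathbf 1^\top u=0$; here $Z[S]$ is the principal submatrix. The number $\lambda_S(Z)$ is called the candidate value of $S$ (for $S=\{i\}$, $\lambda_S(Z)=Z_{ii}$). Theorem (universal exactness). For each $n\geq 1$ let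 $Q=Q^{(n)}$ be a random symmetric $n\times n$ matrix whose entries $Q_{ij}$, $1\le i\le j\le n$, are mutually independent, whose diagonal entries have a common law with distribution function $F_D$ and whose off-diagonal entries have a common law with distribution function $F_O$; both laws are absolutely continuous with respect to Lebesgue measure and do not depend on $n$. Let $m_n=\min_iQ_{ii}$ and suppose that $$n^5\,\mathbb E\bigl[F_O(m_n)^4\bigr]\to0\qquad(n\to\infty).$$ Let $M=Q-m_nE$, let $G_n^-$ be the graph on $\{1,\dots,n\}$ in which $i\ne j$ are adjacent when $M_{ij}<0$, let $\mathcal C(G_n^-)$ be the set of its connected components, and let $\mathcal E_n$ be the event that $|C|\le4$ for every $C\in\mathcal C(G_n^-)$. Then: 1. $\mathbb P(Q\text{ has a unique DNN optimizer, and it has rank one})\to1$. 2. $\mathbb P(\mathcal E_n)\to1$. 3. For every $n\ge1$, on $\mathcal E_n$, $\vartheta(M)=\min_{C\in\mathcal C(G_n^-)}\vartheta(M[C])$, and every local relaxation is exact: $\vartheta(M[C])=\mu(M[C])$ for every $C\in\mathcal C(G_n^-)$. 4. For every $n\ge1$, almost surely on $\mathcal E_n$: any two distinct admissible sets $S,T$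 for $M$, each contained in a component of $G_n^-$, have $\lambda_S(M)\ne\lambda_T(M)$; the values $\vartheta(M[C])$, $C\in\mathcal C(G_n^-)$, are pairwise distinct; and each of $M$ and $Q$ has a unique DNN optimizer, which has rank one. -/

import Mathlib

open MeasureTheory ProbabilityTheory Filter Topology Matrix

noncomputable section

/-! ### The doubly nonnegative (DNN) relaxation and the standard quadratic program -/

section Programs

variable {ι : Type*} [Fintype ι]

/-- The trace inner product `⟨Z, Y⟩ = ∑ i j, Z i j * Y i j`. -/
def matInner (Z Y : Matrix ι ι ℝ) : ℝ := ∑ i, ∑ j, Z i j * Y i j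

/-- The feasible set of the DNN program: `⟨E, Y⟩ = 1`, `Y ⪰ 0`, `Y ≥ 0` entrywise. -/
def dnnFeasible (ι : Type*) [Fintype ι] : Set (Matrix ι ι ℝ) :=
  {Y | matInner (Matrix.of fun _ _ => (1 : ℝ)) Y = 1 ∧ Y.PosSemidef ∧ ∀ i j, 0 ≤ Y i j}

/-- The DNN value `ϑ(Z)`; the infimum is a minimum by `dnnValue_isLeast`. -/
def dnnValue (Z : Matrix ι ι ℝ) : ℝ := sInf (matInner Z '' dnnFeasible ι)

/-- `X` is an optimizer of the DNN program with objective `⟨Z, ·⟩`. -/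
def IsDNNOptimizer (Z X : Matrix ι ι ℝ) : Prop :=
  X ∈ dnnFeasible ι ∧ ∀ Y ∈ dnnFeasible ι, matInner Z X ≤ matInner Z Y

/-- The DNN program with objective `⟨Z, ·⟩` has exactly one optimizer, and it has rank one. -/
def HasUniqueRankOneOptimizer (Z : Matrix ι ι ℝ) : Prop :=
  ∃ X, IsDNNOptimizer Z X ∧ X.rank = 1 ∧ ∀ Y, IsDNNOptimizer Z Y → Y = X

/-- The value `μ(Z)` of the standard quadratic program over the simplex; the infimum is a minimum
by `stqpValue_isLeast`. -/
def stqpValue (Z : Matrix ι ι ℝ) : ℝ := sInf ((fun x : ι → ℝ => x ⬝ᵥ Z *ᵥ x) '' stdSimplex ℝ ι)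

theorem continuous_matInner (Z : Matrix ι ι ℝ) : Continuous (matInner Z) :=
  continuous_finsetSum _ fun i _ => continuous_finsetSum _ fun j _ =>
    continuous_const.mul (continuous_id.matrix_elem i j)

theorem isCompact_dnnFeasible : IsCompact (dnnFeasible ι) := by
  have hsub : dnnFeasible ι ⊆
      Set.univ.pi fun _ : ι => Set.univ.pi fun _ : ι => Set.Icc (0 : ℝ) 1 := by
    rintro Y ⟨h1, -, h3⟩ i - j -
    refine ⟨h3 i j, ?_⟩
    simp only [matInner, Matrix.of_apply, one_mul] at h1
    calc Y i j ≤ ∑ j', Y i j' :=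
          Finset.single_le_sum (f := fun j' => Y i j') (fun j' _ => h3 i j') (Finset.mem_univ j)
      _ ≤ ∑ i', ∑ j', Y i' j' :=
          Finset.single_le_sum (f := fun i' => ∑ j', Y i' j')
            (fun i' _ => Finset.sum_nonneg fun j' _ => h3 i' j') (Finset.mem_univ i)
      _ = 1 := h1
  have hK : IsCompact (Set.univ.pi fun _ : ι => Set.univ.pi fun _ : ι => Set.Icc (0 : ℝ) 1) :=
    isCompact_univ_pi fun _ => isCompact_univ_pi fun _ => isCompact_Icc
  have e : ∀ i j : ι, Continuous fun Y : Matrix ι ι ℝ => Y i j := fun i j =>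
    continuous_id.matrix_elem i j
  have c1 : IsClosed {Y : Matrix ι ι ℝ | matInner (Matrix.of fun _ _ => (1 : ℝ)) Y = 1} :=
    isClosed_eq (continuous_matInner _) continuous_const
  have c2 : IsClosed {Y : Matrix ι ι ℝ | Y.PosSemidef} := by
    have h : {Y : Matrix ι ι ℝ | Y.PosSemidef} =
        (⋂ i, ⋂ j, {Y : Matrix ι ι ℝ | Y j i = Y i j}) ∩
          ⋂ x : ι → ℝ, {Y : Matrix ι ι ℝ | 0 ≤ ∑ i, x i * ∑ j, Y i j * x j} := by
      ext Y
      have h := @Matrix.posSemidef_iff_dotProduct_mulVec ι ℝ _ _ _ _ Y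
      simp only [dotProduct, Matrix.mulVec, star_trivial, Matrix.IsHermitian.ext_iff] at h
      simpa using h
    rw [h]
    refine IsClosed.inter ?_ ?_
    · exact isClosed_iInter fun i => isClosed_iInter fun j => isClosed_eq (e j i) (e i j)
    · exact isClosed_iInter fun x => isClosed_le continuous_const <|
        continuous_finsetSum _ fun i _ => continuous_const.mul <|
          continuous_finsetSum _ fun j _ => (e i j).mul continuous_const
  have c3 : IsClosed {Y : Matrix ι ι ℝ | ∀ i j, 0 ≤ Y i j} := by
    have h : {Y : Matrix ι ι ℝ | ∀ i j, 0 ≤ Y i j} =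
        ⋂ i, ⋂ j, {Y : Matrix ι ι ℝ | 0 ≤ Y i j} := by
      ext Y
      simp
    rw [h]
    exact isClosed_iInter fun i => isClosed_iInter fun j => isClosed_le continuous_const (e i j)
  exact hK.of_isClosed_subset (c1.inter (c2.inter c3)) hsub

theorem dnnFeasible_nonempty [Nonempty ι] : (dnnFeasible ι).Nonempty := by
  classical
  obtain ⟨i⟩ := ‹Nonempty ι›
  refine ⟨Matrix.diagonal (Pi.single i 1), ?_, ?_, fun a b => ?_⟩
  · simp [matInner, Matrix.diagonal_apply]
  · exact Matrix.PosSemidef.diagonal fun a => by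
      by_cases h : a = i <;> simp [h]
  · simp only [Matrix.diagonal_apply, Pi.single_apply]
    split_ifs <;> norm_num

/-- The DNN value is an attained minimum. -/
theorem dnnValue_isLeast [Nonempty ι] (Z : Matrix ι ι ℝ) :
    IsLeast (matInner Z '' dnnFeasible ι) (dnnValue Z) := by
  exact (isCompact_dnnFeasible.image (continuous_matInner Z)).isLeast_sInf
    (dnnFeasible_nonempty.image _)

/-- The value of the standard quadratic program is an attained minimum. -/
theorem stqpValue_isLeast [Nonempty ι] (Z : Matrix ι ι ℝ) :
    IsLeast ((fun x : ι → ℝ => x ⬝ᵥ Z *ᵥ x) '' stdSimplex ℝ ι) (stqpValue Z) := by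
  have hc : Continuous fun x : ι → ℝ => x ⬝ᵥ Z *ᵥ x := by
    simp only [dotProduct, Matrix.mulVec]
    fun_prop
  classical
  obtain ⟨i⟩ := ‹Nonempty ι›
  exact ((isCompact_stdSimplex ℝ ι).image hc).isLeast_sInf
    (Set.Nonempty.image _ ⟨_, single_mem_stdSimplex ℝ i⟩)

end Programs

/-! ### Principal submatrices and KKT candidates -/

section Candidates

variable {ι : Type*}

/-- The principal submatrix `A[S]`. -/
def principalSub (A : Matrix ι ι ℝ) (S : Finset ι) : Matrix S S ℝ :=
  A.submatrix Subtype.val Subtype.val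

variable [DecidableEq ι]

/-- The bordered KKT matrix with blocks `A[S]`, `-1`, `1ᵀ`, `0`. -/
def kktMatrix (A : Matrix ι ι ℝ) (S : Finset ι) : Matrix (S ⊕ Unit) (S ⊕ Unit) ℝ :=
  Matrix.fromBlocks (principalSub A S) (Matrix.of fun _ _ => -1) (Matrix.of fun _ _ => 1) 0

/-- The solution `(x, lam)` of `A[S] x = lam 1`, `1ᵀ x = 1`, which is unique when
`det (kktMatrix A S) ≠ 0`. For `S = {i}` the determinant is `1` and the solution is `(1, A i i)`. -/
def kktSolution (A : Matrix ι ι ℝ) (S : Finset ι) : S ⊕ Unit → ℝ :=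
  (kktMatrix A S)⁻¹ *ᵥ Sum.elim (fun _ => 0) (fun _ => 1)

/-- The candidate vector on the support `S`. -/
def candidateVector (A : Matrix ι ι ℝ) (S : Finset ι) : S → ℝ := fun i => kktSolution A S (.inl i)

/-- The candidate value of the support `S`. -/
def candidateValue (A : Matrix ι ι ℝ) (S : Finset ι) : ℝ := kktSolution A S (.inr ())

/-- Admissible supports: singletons, and sets of size at least two for which the KKT matrix is
invertible, the candidate vector is positive, and `A[S]` is positive definite on the tangent space
`{u | 1ᵀ u = 0}`. -/
def Admissible (A : Matrix ι ι ℝ) (S : Finset ι) : Prop :=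
  S.card = 1 ∨
    (2 ≤ S.card ∧ (kktMatrix A S).det ≠ 0 ∧ (∀ i, 0 < candidateVector A S i) ∧
      ∀ u : S → ℝ, ∑ i, u i = 0 → u ≠ 0 → 0 < u ⬝ᵥ principalSub A S *ᵥ u)

end Candidates

/-! ### The shifted matrix and its defect graph -/

section Defect

variable {n : ℕ}

/-- `m_n`, the smallest diagonal entry (for `0 < n`). -/
def diagMin (Q : Matrix (Fin n) (Fin n) ℝ) : ℝ := ⨅ i, Q i i

/-- The shifted matrix `M = Q - m_n E`. -/
def shifted (Q : Matrix (Fin n) (Fin n) ℝ) : Matrix (Fin n) (Fin n) ℝ :=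
  Q - diagMin Q • Matrix.of fun _ _ => (1 : ℝ)

/-- The defect graph: `{i, j}` with `i < j` is an edge when `M i j < 0`. -/
def defectGraph (Q : Matrix (Fin n) (Fin n) ℝ) : SimpleGraph (Fin n) :=
  SimpleGraph.fromRel fun i j => i < j ∧ shifted Q i j < 0

/-- The set of vertices of a connected component. -/
def compVerts {G : SimpleGraph (Fin n)} (C : G.ConnectedComponent) : Finset (Fin n) :=
  C.supp.toFinite.toFinset

/-- Every connected component of the defect graph has at most four vertices. -/
def SmallComponents (Q : Matrix (Fin n) (Fin n) ℝ) : Prop :=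
  ∀ C : (defectGraph Q).ConnectedComponent, (compVerts C).card ≤ 4

/-- `S` is contained in a connected component of the defect graph. -/
def InsideComponent (Q : Matrix (Fin n) (Fin n) ℝ) (S : Finset (Fin n)) : Prop :=
  ∃ C : (defectGraph Q).ConnectedComponent, S ⊆ compVerts C

/-- `Q` is a random symmetric matrix whose entries on and above the diagonal are mutually
independent, with diagonal entries of law `νD` and off-diagonal entries of law `νO`. -/
structure IsRandomSymm {Ω : Type*} [MeasurableSpace Ω] (P : Measure Ω)
    (Q : Ω → Matrix (Fin n) (Fin n) ℝ) (νD νO : Measure ℝ) : Prop where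
  measurable : ∀ i j, Measurable fun ω => Q ω i j
  symm : ∀ ω, (Q ω).IsSymm
  indep : iIndepFun (fun (p : {p : Fin n × Fin n // p.1 ≤ p.2}) ω => Q ω p.1.1 p.1.2) P
  law_diag : ∀ i, P.map (fun ω => Q ω i i) = νD
  law_off : ∀ i j, i < j → P.map (fun ω => Q ω i j) = νO

end Defect

end

/-!
The diagonal of `M = Q - m E` is nonnegative and vanishes somewhere, and `M` is nonnegative between
different components of the defect graph. Dropping the coupling entries bounds `⟨M, Y⟩` below by
`∑ C, ϑ(M[C]) s_C`, where `s_C` is the mass of `Y` on the block `C` and `∑ C, s_C ≤ 1`; as the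
smallest local value is nonpositive, it is `ϑ(M)` (`dnnValue_isLeast_blocks`). The same estimate
shows that an optimizer has no mass on a block whose local value is not minimal
(`excess_blockMass_le`).

On blocks of order at most four the relaxation is exact, because a doubly nonnegative matrix of
order at most four is completely positive (`IsDNN.mem_cpCone`). Hence the DNN optimizers of `M` are
mixtures of the matrices `x xᵀ` with `x` a minimizer of the quadratic form on the simplex. If the
candidate values of admissible sets are pairwise distinct, such a minimizer is unique
(`IsFaceMin.unique`): where the form is flat along a tangent direction of the support, sliding along
it both ways would produce two minimizers with different smaller supports. Moreover each local value
is then the candidate value of an admissible set in its block, so local values do not tie.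

Ties have probability zero. For `i` in `S` but not in `T`, the candidate value of `T` does not
involve `Q i i`, while that of `S` is strictly increasing in it as long as the candidate vector is
positive (`Tie.diag_eq`). Given all other entries, a tie thus happens for at most one value of the
atomless variable `Q i i`; the random shift `m` moves all candidate values alike.

Finally, a component with more than four vertices contains a tree on five of them, with four edges
at which `Q` is below `m`. Given the diagonal these four entries are independent, and a union bound
over the labelled trees gives `P(E_nᶜ) ≤ 625 n⁵ 𝔼[F_O(m)⁴]`
(`IsRandomSymm.measure_not_smallComponents_le`).
-/

/-! ### Doubly nonnegative matrices of order at most four are completely positive -/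

section CompletelyPositive

variable {ι : Type*}

/-- The doubly nonnegative cone: positive semidefinite and entrywise nonnegative matrices. -/
def IsDNN (Y : Matrix ι ι ℝ) : Prop := Y.PosSemidef ∧ ∀ i j, 0 ≤ Y i j

/-- The completely positive cone: finite sums of matrices `x xᵀ` with `x ≥ 0`. -/
def cpCone (ι : Type*) : AddSubmonoid (Matrix ι ι ℝ) :=
  AddSubmonoid.closure {Y | ∃ x : ι → ℝ, 0 ≤ x ∧ Y = vecMulVec x x}

theorem smul_vecMulVec_mem_cpCone {x : ι → ℝ} (hx : 0 ≤ x) {c : ℝ} (hc : 0 ≤ c) :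
    c • vecMulVec x x ∈ cpCone ι := by
  refine AddSubmonoid.subset_closure ⟨Real.sqrt c • x, smul_nonneg (Real.sqrt_nonneg c) hx, ?_⟩
  ext i j
  simp only [Matrix.smul_apply, vecMulVec_apply, Pi.smul_apply, smul_eq_mul]
  linear_combination (-(x i * x j)) * Real.mul_self_sqrt hc

theorem Matrix.PosSemidef.apply_comm {Y : Matrix ι ι ℝ} (hY : Y.PosSemidef) (i j : ι) :
    Y i j = Y j i := by
  simpa using hY.isHermitian.apply j i

variable [Fintype ι]

theorem Matrix.PosSemidef.apply_eq_zero_of_diag {Y : Matrix ι ι ℝ} (hY : Y.PosSemidef) {i : ι}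
    (hi : Y i i = 0) (j : ι) : Y i j = 0 ∧ Y j i = 0 := by
  classical
  have h : Y *ᵥ Pi.single i 1 = 0 := (hY.dotProduct_mulVec_zero_iff _).1 (by simp [hi])
  have h1 : Y j i = 0 := by simpa using congrFun h j
  exact ⟨(hY.apply_comm i j).trans h1, h1⟩

theorem posSemidef_vecMulVec_real (x : ι → ℝ) : (vecMulVec x x).PosSemidef := by
  simpa using posSemidef_vecMulVec_self_star x

/-- Schur complement: clearing the `i`-th row and column of a positive semidefinite matrix by
subtracting a rank-one matrix preserves positive semidefiniteness. -/
theorem Matrix.PosSemidef.sub_schur {Y : Matrix ι ι ℝ} (hY : Y.PosSemidef) {i : ι}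
    (hi : 0 < Y i i) : (Y - (Y i i)⁻¹ • vecMulVec (Y i) (Y i)).PosSemidef := by
  classical
  refine posSemidef_iff_dotProduct_mulVec.2 ⟨?_, fun x => ?_⟩
  · ext a b
    simp [vecMulVec_apply, hY.apply_comm a b, mul_comm (Y i a)]
  · set c := (Y i i)⁻¹ * (Y i ⬝ᵥ x) with hc
    have h := (posSemidef_iff_dotProduct_mulVec.1 hY).2 (x - c • Pi.single i 1)
    have e1 : Y *ᵥ Pi.single i 1 = Y i := by
      ext a; simp [hY.apply_comm a i]
    have e2 : (Pi.single i 1 : ι → ℝ) ⬝ᵥ Y *ᵥ x = Y i ⬝ᵥ x := by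
      rw [single_one_dotProduct]; rfl
    have e3 : (Pi.single i 1 : ι → ℝ) ⬝ᵥ Y i = Y i i := by simp
    have e4 : vecMulVec (Y i) (Y i) *ᵥ x = (Y i ⬝ᵥ x) • Y i := by
      ext a; simp [vecMulVec_mulVec, mul_comm]
    simp only [star_trivial, mulVec_sub, mulVec_smul, e1, dotProduct_sub, sub_dotProduct,
      smul_dotProduct, dotProduct_smul, e2, e3, smul_eq_mul, sub_mulVec, smul_mulVec, e4] at h ⊢
    rw [dotProduct_comm x (Y i)] at h ⊢
    have : c * Y i i = Y i ⬝ᵥ x := by rw [hc]; field_simp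
    have : c * (c * Y i i) = c * (Y i ⬝ᵥ x) := by rw [this]
    rw [← mul_assoc, ← hc]
    linarith

/-- A doubly nonnegative matrix with at most four nonzero diagonal entries, two of which sit at
positions `i`, `j` with `Y i j = 0`, splits into doubly nonnegative matrices of smaller support
(a Schur complement with respect to `i` and `j`, whose only possibly negative entry is repaired by
distributing it over the two rank-one terms). -/
theorem IsDNN.mem_cpCone_of_apply_eq_zero [DecidableEq ι] {Y : Matrix ι ι ℝ} (hY : IsDNN Y)
    {s : Finset ι} (hs : s.card ≤ 4) (hsup : ∀ k, k ∉ s → Y k k = 0)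
    (ih : ∀ (t : Finset ι) (W : Matrix ι ι ℝ), t.card < s.card → IsDNN W →
      (∀ k, k ∉ t → W k k = 0) → W ∈ cpCone ι)
    {i j : ι} (hij : i ≠ j) (hi : 0 < Y i i) (hj : 0 < Y j j) (h0 : Y i j = 0) :
    Y ∈ cpCone ι := by
  obtain ⟨hP, hN⟩ := hY
  have his : i ∈ s := by by_contra h; exact hi.ne' (hsup i h)
  have hjs : j ∈ s := by by_contra h; exact hj.ne' (hsup j h)
  have h0' : Y j i = 0 := (hP.apply_comm j i).trans h0
  set A := (Y i i)⁻¹ • vecMulVec (Y i) (Y i) with hA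
  set B := (Y j j)⁻¹ • vecMulVec (Y j) (Y j) with hB
  set R := Y - A - B with hR
  have hAe : ∀ a b, A a b = (Y i i)⁻¹ * (Y i a * Y i b) := fun a b => by
    simp [hA, vecMulVec_apply]
  have hBe : ∀ a b, B a b = (Y j j)⁻¹ * (Y j a * Y j b) := fun a b => by
    simp [hB, vecMulVec_apply]
  have hRe : ∀ a b, R a b = Y a b - A a b - B a b := fun a b => rfl
  have hA0 : ∀ a b, 0 ≤ A a b := fun a b => by
    rw [hAe]; exact mul_nonneg (inv_nonneg.2 hi.le) (mul_nonneg (hN _ _) (hN _ _))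
  have hB0 : ∀ a b, 0 ≤ B a b := fun a b => by
    rw [hBe]; exact mul_nonneg (inv_nonneg.2 hj.le) (mul_nonneg (hN _ _) (hN _ _))
  have hAP : A.PosSemidef := (posSemidef_vecMulVec_real _).smul (inv_nonneg.2 hi.le)
  have hBP : B.PosSemidef := (posSemidef_vecMulVec_real _).smul (inv_nonneg.2 hj.le)
  have hRP : R.PosSemidef := by
    have h1 := hP.sub_schur hi
    rw [← hA] at h1
    have hrow : (Y - A) j = Y j := by
      ext a
      change Y j a - A j a = _
      rw [hAe, h0]; ring
    have h2 := h1.sub_schur (i := j) (by rw [hrow]; exact hj)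
    rwa [hrow, ← hB] at h2
  have hz : ∀ k, k ∉ s → ∀ l, Y k l = 0 ∧ Y l k = 0 := fun k hk l =>
    hP.apply_eq_zero_of_diag (hsup k hk) l
  have hRi : R i i = 0 := by rw [hRe, hAe, hBe, h0']; field_simp; ring
  have hRj : R j j = 0 := by rw [hRe, hAe, hBe, h0]; field_simp; ring
  have hRs : ∀ k, k ∉ s → R k k = 0 := fun k hk => by
    rw [hRe, hAe, hBe, (hz k hk i).2, (hz k hk j).2, (hz k hk k).1]; ring
  have hRz : ∀ k, k ∉ (s.erase i).erase j → R k k = 0 := fun k hk => by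
    simp only [Finset.mem_erase, not_and_or, not_not] at hk
    rcases hk with rfl | rfl | hk
    · exact hRj
    · exact hRi
    · exact hRs k hk
  have hcard : ((s.erase i).erase j).card + 2 = s.card := by
    have e1 := Finset.card_erase_add_one his
    have e2 := Finset.card_erase_add_one (Finset.mem_erase.2 ⟨hij.symm, hjs⟩)
    omega
  have hdec : Y = R + A + B := by rw [hR]; abel
  by_cases hpos : ∀ k l, 0 ≤ R k l
  · rw [hdec]
    refine add_mem (add_mem (ih _ R ?_ ⟨hRP, hpos⟩ hRz) ?_) ?_
    · omega
    · exact smul_vecMulVec_mem_cpCone (fun _ => hN _ _) (inv_nonneg.2 hi.le)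
    · exact smul_vecMulVec_mem_cpCone (fun _ => hN _ _) (inv_nonneg.2 hj.le)
  · push Not at hpos
    obtain ⟨k, l, hkl⟩ := hpos
    have hne : k ≠ l := by rintro rfl; exact absurd hRP.diag_nonneg (not_le.2 hkl)
    have hk : k ∈ (s.erase i).erase j := by
      by_contra h; exact hkl.ne (hRP.apply_eq_zero_of_diag (hRz k h) l).1
    have hl : l ∈ (s.erase i).erase j := by
      by_contra h; exact hkl.ne (hRP.apply_eq_zero_of_diag (hRz l h) k).2
    -- `s` is `{i, j, k, l}`, so `(k, l)` and `(l, k)` are the only places where `R` is negative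
    have hset : {k, l} = (s.erase i).erase j := by
      refine Finset.eq_of_subset_of_card_le ?_ ?_
      · intro a ha
        simp only [Finset.mem_insert, Finset.mem_singleton] at ha
        rcases ha with rfl | rfl <;> assumption
      · rw [Finset.card_pair hne]; omega
    have hRnn : ∀ a b, (a = k ∧ b = l) ∨ (a = l ∧ b = k) ∨ 0 ≤ R a b := by
      intro a b
      by_cases ha : a ∈ (s.erase i).erase j
      · by_cases hb : b ∈ (s.erase i).erase j
        · rw [← hset] at ha hb
          simp only [Finset.mem_insert, Finset.mem_singleton] at ha hb
          rcases ha with rfl | rfl <;> rcases hb with rfl | rfl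
          · exact Or.inr (Or.inr hRP.diag_nonneg)
          · exact Or.inl ⟨rfl, rfl⟩
          · exact Or.inr (Or.inl ⟨rfl, rfl⟩)
          · exact Or.inr (Or.inr hRP.diag_nonneg)
        · exact Or.inr (Or.inr (hRP.apply_eq_zero_of_diag (hRz b hb) a).2.ge)
      · exact Or.inr (Or.inr (hRP.apply_eq_zero_of_diag (hRz a ha) b).1.ge)
    have hsum : 0 < A k l + B k l := by
      have := hN k l
      have := hRe k l
      linarith
    -- a nonnegative rank-one term absorbs its share `u / (A k l + B k l)` of `R`, `u` its own entry
    have key : ∀ (C : Matrix ι ι ℝ) (p : ι), p ∈ s → C.PosSemidef → (∀ a b, 0 ≤ C a b) →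
        C p p = 0 → (∀ a, a ∉ s → C a a = 0) → R p p = 0 →
        C + (C k l / (A k l + B k l)) • R ∈ cpCone ι := by
      intro C p hp hCP hC0 hCp hCs hRp
      have ht : 0 ≤ C k l / (A k l + B k l) := div_nonneg (hC0 k l) hsum.le
      refine ih (s.erase p) _ (Finset.card_erase_lt_of_mem hp) ⟨hCP.add (hRP.smul ht), ?_⟩ ?_
      · have hkl' : 0 ≤ C k l + C k l / (A k l + B k l) * R k l := by
          have : C k l + C k l / (A k l + B k l) * R k l
              = C k l / (A k l + B k l) * Y k l := by
            rw [hRe]; field_simp; ring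
          rw [this]; exact mul_nonneg ht (hN _ _)
        intro a b
        simp only [Matrix.add_apply, Matrix.smul_apply, smul_eq_mul]
        rcases hRnn a b with ⟨rfl, rfl⟩ | ⟨rfl, rfl⟩ | h
        · exact hkl'
        · rwa [hCP.apply_comm a b, hRP.apply_comm a b]
        · exact add_nonneg (hC0 a b) (mul_nonneg ht h)
      · intro a ha
        simp only [Finset.mem_erase, not_and_or, not_not] at ha
        simp only [Matrix.add_apply, Matrix.smul_apply, smul_eq_mul]
        rcases ha with rfl | ha
        · rw [hCp, hRp]; ring
        · rw [hCs a ha, hRs a ha]; ring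
    have e : Y = (A + (A k l / (A k l + B k l)) • R) + (B + (B k l / (A k l + B k l)) • R) := by
      have h1 : A k l / (A k l + B k l) + B k l / (A k l + B k l) = 1 := by field_simp
      have h2 : (A k l / (A k l + B k l)) • R + (B k l / (A k l + B k l)) • R = R := by
        rw [← add_smul, h1, one_smul]
      calc Y = A + B + R := by rw [hdec]; abel
        _ = A + B + ((A k l / (A k l + B k l)) • R + (B k l / (A k l + B k l)) • R) := by rw [h2]
        _ = _ := by abel
    rw [e]
    refine add_mem (key A j hjs hAP hA0 ?_ ?_ hRj) (key B i his hBP hB0 ?_ ?_ hRi)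
    · rw [hAe, h0]; ring
    · intro a ha; rw [hAe, (hz a ha i).2]; ring
    · rw [hBe, h0']; ring
    · intro a ha; rw [hBe, (hz a ha j).2]; ring

/-- **Maxfield–Minc.** A doubly nonnegative matrix with at most four nonzero diagonal entries is
completely positive. If all entries on the support are positive, a multiple of `y yᵀ`, with `y` a
column, is subtracted until a diagonal or an off-diagonal entry vanishes. -/
theorem IsDNN.mem_cpCone {Y : Matrix ι ι ℝ} (hY : IsDNN Y) {s : Finset ι} (hs : s.card ≤ 4)
    (hsup : ∀ k, k ∉ s → Y k k = 0) : Y ∈ cpCone ι := by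
  classical
  induction hm : s.card using Nat.strong_induction_on generalizing s Y with
  | _ m ih =>
  subst hm
  replace ih : ∀ (t : Finset ι) (W : Matrix ι ι ℝ), t.card < s.card → IsDNN W →
      (∀ k, k ∉ t → W k k = 0) → W ∈ cpCone ι := fun t W ht hW hWt =>
    ih t.card ht hW (by omega) hWt rfl
  obtain ⟨hP, hN⟩ := hY
  by_cases hdiag : ∃ i ∈ s, Y i i = 0
  · obtain ⟨i, his, hi⟩ := hdiag
    refine ih (s.erase i) Y (Finset.card_erase_lt_of_mem his) ⟨hP, hN⟩ fun k hk => ?_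
    simp only [Finset.mem_erase, not_and_or, not_not] at hk
    rcases hk with rfl | hk
    exacts [hi, hsup k hk]
  push Not at hdiag
  rcases s.eq_empty_or_nonempty with rfl | ⟨i, his⟩
  · have : Y = 0 := by
      ext a b
      exact (hP.apply_eq_zero_of_diag (hsup a (by simp)) b).1
    rw [this]; exact zero_mem _
  have hi : 0 < Y i i := lt_of_le_of_ne (hN i i) (hdiag i his).symm
  set V := vecMulVec (Y i) (Y i) with hV
  have hVe : ∀ a b, V a b = Y i a * Y i b := fun a b => rfl
  set R := Y - (Y i i)⁻¹ • V with hR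
  have hRP : R.PosSemidef := hP.sub_schur hi
  have hRe : ∀ a b, R a b = Y a b - (Y i i)⁻¹ * (Y i a * Y i b) := fun a b => rfl
  have hcp : ∀ c : ℝ, 0 ≤ c → c • V ∈ cpCone ι := fun c hc =>
    smul_vecMulVec_mem_cpCone (fun _ => hN _ _) hc
  have hz : ∀ k, k ∉ s → Y i k = 0 := fun k hk => (hP.apply_eq_zero_of_diag (hsup k hk) i).2
  by_cases hpos : ∀ k l, 0 ≤ R k l
  · have e : Y = R + (Y i i)⁻¹ • V := by rw [hR]; abel
    rw [e]
    refine add_mem (ih (s.erase i) R (Finset.card_erase_lt_of_mem his) ⟨hRP, hpos⟩ ?_)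
      (hcp _ (inv_nonneg.2 hi.le))
    intro k hk
    simp only [Finset.mem_erase, not_and_or, not_not] at hk
    rw [hRe]
    rcases hk with rfl | hk
    · field_simp; ring
    · rw [hsup k hk, hz k hk]; ring
  · -- subtract up to the first time an entry of `Y - t y yᵀ` vanishes
    have hne : (Finset.univ.filter fun p : ι × ι => R p.1 p.2 < 0).Nonempty := by
      push Not at hpos
      obtain ⟨k, l, h⟩ := hpos
      exact ⟨(k, l), by simpa using h⟩
    obtain ⟨⟨k, l⟩, hkl, hmin⟩ := Finset.exists_min_image _
      (fun p : ι × ι => Y p.1 p.2 / (Y i p.1 * Y i p.2)) hne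
    simp only [Finset.mem_filter, Finset.mem_univ, true_and, Prod.forall] at hkl hmin
    have hii : (0 : ℝ) < (Y i i)⁻¹ := inv_pos.2 hi
    have hVpos : ∀ a b, R a b < 0 → 0 < Y i a * Y i b := fun a b hab => by
      have h1 := hRe a b
      have h2 := hN a b
      by_contra h
      have h3 : (Y i i)⁻¹ * (Y i a * Y i b) ≤ 0 :=
        mul_nonpos_of_nonneg_of_nonpos hii.le (not_lt.1 h)
      linarith
    have hklV := hVpos k l hkl
    set t := Y k l / (Y i k * Y i l) with ht
    have ht0 : 0 ≤ t := div_nonneg (hN _ _) hklV.le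
    have ht1 : t < (Y i i)⁻¹ := by
      rw [ht, div_lt_iff₀ hklV]
      have := hRe k l
      linarith
    have htY : t * Y i i < 1 := by
      calc t * Y i i < (Y i i)⁻¹ * Y i i := mul_lt_mul_of_pos_right ht1 hi
        _ = 1 := inv_mul_cancel₀ hi.ne'
    set W := Y - t • V with hW
    have hWe : ∀ a b, W a b = Y a b - t * (Y i a * Y i b) := fun a b => rfl
    have hWP : W.PosSemidef := by
      have : W = (1 - t * Y i i) • Y + (t * Y i i) • R := by
        ext a b
        simp only [Matrix.add_apply, Matrix.smul_apply, smul_eq_mul, hRe, hWe]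
        field_simp; ring
      rw [this]
      exact (hP.smul (by linarith)).add (hRP.smul (mul_nonneg ht0 hi.le))
    have hWN : ∀ a b, 0 ≤ W a b := fun a b => by
      rw [hWe]
      by_cases h : R a b < 0
      · have h1 := hmin a b h
        rw [le_div_iff₀ (hVpos a b h)] at h1
        linarith
      · have h1 := hRe a b
        have h2 : t * (Y i a * Y i b) ≤ (Y i i)⁻¹ * (Y i a * Y i b) :=
          mul_le_mul_of_nonneg_right ht1.le (mul_nonneg (hN _ _) (hN _ _))
        linarith
    have hWd : ∀ a ∈ s, 0 < W a a := fun a ha => by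
      have h1 : 0 < Y a a := lt_of_le_of_ne (hN a a) (hdiag a ha).symm
      have h2 : 0 ≤ R a a := hRP.diag_nonneg
      have h3 : W a a = (1 - t * Y i i) * Y a a + (t * Y i i) * R a a := by
        rw [hWe, hRe]; field_simp; ring
      rw [h3]
      have h4 : 0 < (1 - t * Y i i) * Y a a := mul_pos (by linarith) h1
      have h5 : 0 ≤ (t * Y i i) * R a a := mul_nonneg (mul_nonneg ht0 hi.le) h2
      linarith
    have hks : k ∈ s := by
      by_contra h; rw [hz k h, zero_mul] at hklV; exact hklV.false
    have hls : l ∈ s := by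
      by_contra h; rw [hz l h, mul_zero] at hklV; exact hklV.false
    have hne' : k ≠ l := by
      rintro rfl; exact absurd hRP.diag_nonneg (not_le.2 hkl)
    have hW0 : W k l = 0 := by rw [hWe, ht, div_mul_cancel₀ _ hklV.ne', sub_self]
    have e : Y = W + t • V := by rw [hW]; abel
    rw [e]
    refine add_mem ?_ (hcp t ht0)
    refine IsDNN.mem_cpCone_of_apply_eq_zero ⟨hWP, hWN⟩ hs ?_ ih hne' (hWd k hks) (hWd l hls) hW0
    intro a ha
    rw [hWe, hsup a ha, hz a ha]; ring

end CompletelyPositive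

/-! ### Minimizers of the standard quadratic program on a face -/

section FaceMinimizers

variable {ι : Type*} [Fintype ι]

theorem matInner_ones (Y : Matrix ι ι ℝ) :
    matInner (Matrix.of fun _ _ => (1 : ℝ)) Y = ∑ i, ∑ j, Y i j := by
  simp [matInner]

theorem matInner_add (Z Y W : Matrix ι ι ℝ) : matInner Z (Y + W) = matInner Z Y + matInner Z W := by
  simp [matInner, mul_add, Finset.sum_add_distrib]

theorem matInner_smul (Z Y : Matrix ι ι ℝ) (c : ℝ) : matInner Z (c • Y) = c * matInner Z Y := by
  simp only [matInner, Matrix.smul_apply, smul_eq_mul, Finset.mul_sum]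
  exact Finset.sum_congr rfl fun i _ => Finset.sum_congr rfl fun j _ => by ring

theorem matInner_vecMulVec (Z : Matrix ι ι ℝ) (x : ι → ℝ) :
    matInner Z (vecMulVec x x) = x ⬝ᵥ Z *ᵥ x := by
  simp only [matInner, vecMulVec_apply, dotProduct, mulVec, Finset.mul_sum]
  exact Finset.sum_congr rfl fun i _ => Finset.sum_congr rfl fun j _ => by ring

theorem sum_vecMulVec (x : ι → ℝ) : ∑ i, ∑ j, vecMulVec x x i j = (∑ i, x i) ^ 2 := by
  simp only [vecMulVec_apply, sq, Finset.sum_mul_sum]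

theorem vecMulVec_mem_dnnFeasible {x : ι → ℝ} (hx : x ∈ stdSimplex ℝ ι) :
    vecMulVec x x ∈ dnnFeasible ι := by
  refine ⟨?_, posSemidef_vecMulVec_real x, fun i j => mul_nonneg (hx.1 i) (hx.1 j)⟩
  rw [matInner_ones, sum_vecMulVec, hx.2, one_pow]

/-- On the completely positive cone, `⟨M, ·⟩` is bounded below by `v ⟨E, ·⟩` when `v` bounds the
quadratic form below on the simplex; if `v` is attained at `x₀` only, equality forces a multiple of
`x₀ x₀ᵀ`. -/
theorem mem_cpCone_le_matInner {M Y : Matrix ι ι ℝ} {v : ℝ}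
    (hv : ∀ x ∈ stdSimplex ℝ ι, v ≤ x ⬝ᵥ M *ᵥ x) (hY : Y ∈ cpCone ι) :
    v * ∑ i, ∑ j, Y i j ≤ matInner M Y ∧
      ∀ x₀ : ι → ℝ, (∀ x ∈ stdSimplex ℝ ι, x ⬝ᵥ M *ᵥ x = v → x = x₀) →
        matInner M Y = v * ∑ i, ∑ j, Y i j → Y = (∑ i, ∑ j, Y i j) • vecMulVec x₀ x₀ := by
  induction hY using AddSubmonoid.closure_induction with
  | mem Y h =>
    obtain ⟨x, hx, rfl⟩ := h
    rw [sum_vecMulVec, matInner_vecMulVec]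
    rcases (Finset.sum_nonneg fun i _ => hx i : 0 ≤ ∑ i, x i).eq_or_lt with h0 | h0
    · have : x = 0 := by
        ext i
        exact (Finset.sum_eq_zero_iff_of_nonneg fun i _ => hx i).1 h0.symm i (Finset.mem_univ i)
      subst this
      simp
    · set σ := ∑ i, x i with hσ
      set z := σ⁻¹ • x with hz
      have hzs : z ∈ stdSimplex ℝ ι := by
        refine ⟨fun i => mul_nonneg (inv_nonneg.2 h0.le) (hx i), ?_⟩
        simp only [hz, Pi.smul_apply, smul_eq_mul, ← Finset.mul_sum, ← hσ]
        exact inv_mul_cancel₀ h0.ne'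
      have hxz : x = σ • z := by rw [hz, smul_smul, mul_inv_cancel₀ h0.ne', one_smul]
      have hq : x ⬝ᵥ M *ᵥ x = σ ^ 2 * (z ⬝ᵥ M *ᵥ z) := by
        rw [hxz]
        simp only [mulVec_smul, smul_dotProduct, dotProduct_smul, smul_eq_mul]
        ring
      have hσ2 : 0 < σ ^ 2 := by positivity
      refine ⟨?_, fun x₀ hx₀ heq => ?_⟩
      · rw [hq, mul_comm]
        exact mul_le_mul_of_nonneg_left (hv z hzs) hσ2.le
      · rw [hq, mul_comm v] at heq
        have := hx₀ z hzs (mul_left_cancel₀ hσ2.ne' heq)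
        rw [hxz, this]
        ext i j
        simp only [vecMulVec_apply, Pi.smul_apply, Matrix.smul_apply, smul_eq_mul]
        ring
  | zero => simp [matInner]
  | add Y W hY hW ihY ihW =>
    simp only [Matrix.add_apply, Finset.sum_add_distrib, matInner_add, mul_add]
    refine ⟨add_le_add ihY.1 ihW.1, fun x₀ hx₀ heq => ?_⟩
    have h1 := ihY.1
    have h2 := ihW.1
    have e1 := ihY.2 x₀ hx₀ (by linarith)
    have e2 := ihW.2 x₀ hx₀ (by linarith)
    rw [add_smul, ← e1, ← e2]

/-- `x` minimizes the quadratic form of `M` over the face of the simplex spanned by `C`. -/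
structure IsFaceMin (M : Matrix ι ι ℝ) (C : Finset ι) (x : ι → ℝ) : Prop where
  mem : x ∈ stdSimplex ℝ ι
  supp : ∀ i, i ∉ C → x i = 0
  le : ∀ y ∈ stdSimplex ℝ ι, (∀ i, i ∉ C → y i = 0) → x ⬝ᵥ M *ᵥ x ≤ y ⬝ᵥ M *ᵥ y

theorem quad_add_smul {M : Matrix ι ι ℝ} (hM : M.IsSymm) (x u : ι → ℝ) (t : ℝ) :
    (x + t • u) ⬝ᵥ M *ᵥ (x + t • u) =
      x ⬝ᵥ M *ᵥ x + 2 * t * (u ⬝ᵥ M *ᵥ x) + t ^ 2 * (u ⬝ᵥ M *ᵥ u) := by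
  have h : x ⬝ᵥ M *ᵥ u = u ⬝ᵥ M *ᵥ x := by
    rw [dotProduct_mulVec, dotProduct_comm, ← mulVec_transpose, hM.eq]
  simp only [mulVec_add, mulVec_smul, add_dotProduct, dotProduct_add, smul_dotProduct,
    dotProduct_smul, smul_eq_mul, h]
  ring

/-- Moving in the simplex along a direction tangent to the face of `x`, one hits the boundary of
that face. -/
theorem exists_hit_boundary {x u : ι → ℝ} (hx : x ∈ stdSimplex ℝ ι)
    (hu : ∀ i, x i = 0 → u i = 0) (hsum : ∑ i, u i = 0) (hne : u ≠ 0) :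
    ∃ t : ℝ, 0 < t ∧ (∀ s, 0 ≤ s → s ≤ t → x + s • u ∈ stdSimplex ℝ ι) ∧
      ∃ i, u i < 0 ∧ x i + t * u i = 0 := by
  have hneg : ∃ i, u i < 0 := by
    by_contra! h
    exact hne (funext fun i =>
      (Finset.sum_eq_zero_iff_of_nonneg fun i _ => h i).1 hsum i (Finset.mem_univ i))
  obtain ⟨i₀, hi₀⟩ := hneg
  obtain ⟨i, hi, hmin⟩ := Finset.exists_min_image (Finset.univ.filter fun i => u i < 0)
    (fun i => x i / (-u i)) ⟨i₀, by simpa using hi₀⟩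
  simp only [Finset.mem_filter, Finset.mem_univ, true_and] at hi hmin
  have hpos : ∀ j, u j < 0 → 0 < x j := fun j hj =>
    lt_of_le_of_ne (hx.1 j) fun h => hj.ne (hu j h.symm)
  refine ⟨x i / (-u i), div_pos (hpos i hi) (by linarith), fun s hs hst => ⟨fun j => ?_, ?_⟩,
    i, hi, ?_⟩
  · simp only [Pi.add_apply, Pi.smul_apply, smul_eq_mul]
    rcases lt_or_ge (u j) 0 with hj | hj
    · have h1 := hst.trans (hmin j hj)
      rw [le_div_iff₀ (by linarith)] at h1
      linarith
    · exact add_nonneg (hx.1 j) (mul_nonneg hs hj)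
  · simp only [Pi.add_apply, Pi.smul_apply, smul_eq_mul, Finset.sum_add_distrib,
      ← Finset.mul_sum, hsum, hx.2]
    ring
  · rw [div_neg, neg_mul, div_mul_cancel₀ _ hi.ne, add_neg_cancel]

theorem IsFaceMin.slope_nonneg {M : Matrix ι ι ℝ} (hM : M.IsSymm) {C : Finset ι} {x u : ι → ℝ}
    (hx : IsFaceMin M C x) (hu : ∀ i, x i = 0 → u i = 0) (hsum : ∑ i, u i = 0) :
    0 ≤ u ⬝ᵥ M *ᵥ x := by
  by_cases hne : u = 0
  · simp [hne]
  obtain ⟨t, ht, hmem, -⟩ := exists_hit_boundary hx.mem hu hsum hne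
  by_contra! hb
  set b := u ⬝ᵥ M *ᵥ x
  set c := u ⬝ᵥ M *ᵥ u with hc
  have hc1 : 0 < |c| + 1 := by positivity
  set s := min t (-b / (|c| + 1)) with hs
  have hs0 : 0 < s := lt_min ht (div_pos (by linarith) hc1)
  have h1 := hx.le _ (hmem s hs0.le (min_le_left _ _)) fun i hi => by
    simp [hx.supp i hi, hu i (hx.supp i hi)]
  rw [quad_add_smul hM] at h1
  have h2 : s * (|c| + 1) ≤ -b := by
    rw [← le_div_iff₀ hc1]; exact min_le_right _ _
  have h3 : s * c ≤ s * |c| := mul_le_mul_of_nonneg_left (le_abs_self c) hs0.le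
  have h4 : s * (2 * b + s * c) < 0 := mul_neg_of_pos_of_neg hs0 (by linarith)
  have h5 : 0 ≤ s * (2 * b + s * c) := by linarith
  linarith

theorem IsFaceMin.slope_eq_zero {M : Matrix ι ι ℝ} (hM : M.IsSymm) {C : Finset ι} {x u : ι → ℝ}
    (hx : IsFaceMin M C x) (hu : ∀ i, x i = 0 → u i = 0) (hsum : ∑ i, u i = 0) :
    u ⬝ᵥ M *ᵥ x = 0 := by
  refine le_antisymm ?_ (hx.slope_nonneg hM hu hsum)
  have := hx.slope_nonneg hM (u := -u) (fun i hi => by simp [hu i hi]) (by simp [hsum])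
  rw [neg_dotProduct] at this
  linarith

theorem IsFaceMin.mulVec_eq {M : Matrix ι ι ℝ} (hM : M.IsSymm) {C : Finset ι} {x : ι → ℝ}
    (hx : IsFaceMin M C x) {i : ι} (hi : x i ≠ 0) : (M *ᵥ x) i = x ⬝ᵥ M *ᵥ x := by
  classical
  have key : ∀ j, x j ≠ 0 → (M *ᵥ x) j = (M *ᵥ x) i := fun j hj => by
    have h := hx.slope_eq_zero hM (u := Pi.single j 1 - Pi.single i 1) (fun k hk => by
      have h1 : k ≠ j := by rintro rfl; exact hj hk
      have h2 : k ≠ i := by rintro rfl; exact hi hk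
      simp [h1, h2]) (by simp)
    rw [sub_dotProduct, single_one_dotProduct, single_one_dotProduct] at h
    linarith
  have : ∀ j, x j * (M *ᵥ x) j = x j * (M *ᵥ x) i := fun j => by
    by_cases hj : x j = 0
    · simp [hj]
    · rw [key j hj]
  rw [dotProduct, Finset.sum_congr rfl fun j _ => this j, ← Finset.sum_mul, hx.mem.2, one_mul]

/-- A nonzero tangent direction along which the form is not strictly convex leads from a minimizer
to another one on the boundary of its face. -/
theorem IsFaceMin.exists_boundary {M : Matrix ι ι ℝ} (hM : M.IsSymm) {C : Finset ι}
    {x u : ι → ℝ} (hx : IsFaceMin M C x) (hu : ∀ i, x i = 0 → u i = 0) (hsum : ∑ i, u i = 0)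
    (hne : u ≠ 0) (hc : u ⬝ᵥ M *ᵥ u ≤ 0) :
    ∃ y, IsFaceMin M C y ∧ (∀ i, x i = 0 → y i = 0) ∧ (∃ i, u i < 0 ∧ y i = 0) ∧
      ∀ i, 0 < u i → y i ≠ 0 := by
  obtain ⟨t, ht, hmem, i, hi, hi0⟩ := exists_hit_boundary hx.mem hu hsum hne
  refine ⟨x + t • u, ⟨hmem t ht.le le_rfl, fun j hj => ?_, fun y hy hyC => ?_⟩, fun j hj => ?_,
    ⟨i, hi, by simpa using hi0⟩, fun j hj => ?_⟩
  · simp [hx.supp j hj, hu j (hx.supp j hj)]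
  · refine le_trans ?_ (hx.le y hy hyC)
    rw [quad_add_smul hM, hx.slope_eq_zero hM hu hsum]
    have : t ^ 2 * (u ⬝ᵥ M *ᵥ u) ≤ 0 := mul_nonpos_of_nonneg_of_nonpos (sq_nonneg t) hc
    linarith
  · simp [hj, hu j hj]
  · have : 0 < x j + t * u j := add_pos_of_nonneg_of_pos (hx.mem.1 j) (mul_pos ht hj)
    simpa using this.ne'

theorem exists_isFaceMin (M : Matrix ι ι ℝ) {C : Finset ι} (hC : C.Nonempty) :
    ∃ x, IsFaceMin M C x := by
  classical
  have hc : Continuous fun x : ι → ℝ => x ⬝ᵥ M *ᵥ x := by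
    simp only [dotProduct, Matrix.mulVec]
    fun_prop
  have hcl : IsClosed {x : ι → ℝ | ∀ i, i ∉ C → x i = 0} := by
    simp only [Set.ofPred_forall]
    exact isClosed_iInter fun i => isClosed_iInter fun _ =>
      isClosed_eq (continuous_apply i) continuous_const
  obtain ⟨i, hi⟩ := hC
  obtain ⟨x, hx, hmin⟩ := ((isCompact_stdSimplex ℝ ι).inter_right hcl).exists_isMinOn
    ⟨Pi.single i 1, single_mem_stdSimplex ℝ i, fun j hj => by
      have : j ≠ i := by rintro rfl; exact hj hi
      simp [this]⟩ hc.continuousOn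
  exact ⟨x, hx.1, hx.2, fun y hy hyC => hmin ⟨hy, hyC⟩⟩

end FaceMinimizers

/-! ### Supports of minimizers are admissible when candidate values do not tie -/

section Support

variable {ι : Type*}

/-- Extension by zero of a vector indexed by a subset. -/
def extendVec [DecidableEq ι] (S : Finset ι) (w : S → ℝ) : ι → ℝ := fun i => if h : i ∈ S then w ⟨i, h⟩ else 0

theorem extendVec_coe [DecidableEq ι] (S : Finset ι) (w : S → ℝ) (i : S) : extendVec S w i = w i := by
  simp [extendVec]

theorem extendVec_of_notMem [DecidableEq ι] (S : Finset ι) (w : S → ℝ) {i : ι} (h : i ∉ S) :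
    extendVec S w i = 0 := by
  simp [extendVec, h]

theorem sum_coe_eq_sum [Fintype ι] (S : Finset ι) {f : ι → ℝ} (hf : ∀ i, i ∉ S → f i = 0) :
    ∑ i : S, f i = ∑ i, f i := by
  rw [Finset.sum_coe_sort S f]
  exact Finset.sum_subset (Finset.subset_univ S) fun i _ hi => hf i hi

theorem principalSub_mulVec [Fintype ι] (M : Matrix ι ι ℝ) (S : Finset ι) {u : ι → ℝ}
    (hu : ∀ i, i ∉ S → u i = 0) (i : S) :
    (principalSub M S *ᵥ fun j => u j) i = (M *ᵥ u) i := by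
  simp only [mulVec, dotProduct, principalSub, submatrix_apply]
  exact sum_coe_eq_sum S (f := fun j => M i j * u j) fun j hj => by simp [hu j hj]

theorem principalSub_quad [Fintype ι] (M : Matrix ι ι ℝ) (S : Finset ι) {u : ι → ℝ}
    (hu : ∀ i, i ∉ S → u i = 0) :
    (fun j : S => u j) ⬝ᵥ principalSub M S *ᵥ (fun j => u j) = u ⬝ᵥ M *ᵥ u := by
  rw [dotProduct, Finset.sum_congr rfl fun i _ => by rw [principalSub_mulVec M S hu i]]
  exact sum_coe_eq_sum S (f := fun j => u j * (M *ᵥ u) j) fun j hj => by simp [hu j hj]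

theorem kktMatrix_mulVec (M : Matrix ι ι ℝ) (S : Finset ι) (w : S → ℝ) (s : ℝ) :
    kktMatrix M S *ᵥ Sum.elim w (fun _ => s) =
      Sum.elim (fun i => (principalSub M S *ᵥ w) i - s) (fun _ => ∑ i, w i) := by
  rw [kktMatrix, fromBlocks_mulVec]
  congr 1
  · ext i
    simp [mulVec, dotProduct, sub_eq_add_neg]
  · ext i
    simp [mulVec, dotProduct]

/-- Admissible sets of `M` inside `C` have pairwise distinct candidate values. -/
def NoTie [DecidableEq ι] (M : Matrix ι ι ℝ) (C : Finset ι) : Prop :=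
  ∀ S T : Finset ι, S ⊆ C → T ⊆ C → S ≠ T → Admissible M S → Admissible M T →
    candidateValue M S ≠ candidateValue M T

theorem kktMatrix_det_ne_zero [DecidableEq ι] (M : Matrix ι ι ℝ) {S : Finset ι} (hS : S.Nonempty)
    (hpd : ∀ u : S → ℝ, ∑ i, u i = 0 → u ≠ 0 → 0 < u ⬝ᵥ principalSub M S *ᵥ u) :
    (kktMatrix M S).det ≠ 0 := by
  intro hdet
  obtain ⟨w, hw, hw0⟩ := exists_mulVec_eq_zero_iff.2 hdet
  obtain ⟨u, s, rfl⟩ : ∃ (u : S → ℝ) (s : ℝ), w = Sum.elim u fun _ => s :=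
    ⟨fun i => w (.inl i), w (.inr ()), by ext (i | i) <;> rfl⟩
  rw [kktMatrix_mulVec] at hw0
  have h1 : ∀ i, (principalSub M S *ᵥ u) i = s := fun i => by
    have := congrFun hw0 (.inl i)
    simp only [Sum.elim_inl, Pi.zero_apply] at this
    linarith
  have h2 : ∑ i, u i = 0 := congrFun hw0 (.inr ())
  have hu : u = 0 := by
    by_contra hne
    have := hpd u h2 hne
    simp only [dotProduct, h1, ← Finset.sum_mul, h2, zero_mul] at this
    exact this.false
  obtain ⟨i, hi⟩ := hS
  have hs : s = 0 := by
    rw [← h1 ⟨i, hi⟩, hu]; simp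
  apply hw
  ext (j | j) <;> simp [hu, hs]

theorem kktSolution_eq [DecidableEq ι] {M : Matrix ι ι ℝ} {S : Finset ι} (hdet : (kktMatrix M S).det ≠ 0)
    {w : S → ℝ} {s : ℝ} (h1 : ∀ i, (principalSub M S *ᵥ w) i = s) (h2 : ∑ i, w i = 1) :
    kktSolution M S = Sum.elim w fun _ => s := by
  have h := kktMatrix_mulVec M S w s
  have e : (Sum.elim (fun _ => 0) (fun _ => 1) : S ⊕ Unit → ℝ) =
      kktMatrix M S *ᵥ Sum.elim w (fun _ => s) := by
    rw [h, h2]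
    congr 1
    ext i
    rw [h1, sub_self]
  rw [kktSolution, e, mulVec_mulVec, nonsing_inv_mul _ (isUnit_iff_ne_zero.2 hdet), one_mulVec]

/-- The candidate pair of a set with invertible bordered matrix solves the KKT equations. -/
theorem kktSolution_spec [DecidableEq ι] {M : Matrix ι ι ℝ} {S : Finset ι} (hdet : (kktMatrix M S).det ≠ 0) :
    (∀ i, (principalSub M S *ᵥ candidateVector M S) i = candidateValue M S) ∧
      ∑ i, candidateVector M S i = 1 := by
  have h : kktMatrix M S *ᵥ kktSolution M S = Sum.elim (fun _ => 0) (fun _ => 1) := by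
    rw [kktSolution, mulVec_mulVec, mul_nonsing_inv _ (isUnit_iff_ne_zero.2 hdet), one_mulVec]
  have e : kktSolution M S = Sum.elim (candidateVector M S) fun _ => candidateValue M S := by
    ext (i | i) <;> rfl
  rw [e, kktMatrix_mulVec] at h
  refine ⟨fun i => ?_, congrFun h (.inr ())⟩
  have := congrFun h (.inl i)
  simp only [Sum.elim_inl] at this
  linarith

theorem Admissible.nonempty [DecidableEq ι] {M : Matrix ι ι ℝ} {S : Finset ι} (h : Admissible M S) :
    S.Nonempty := by
  rcases h with h | h
  · exact Finset.card_pos.1 (by omega)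
  · exact Finset.card_pos.1 (by omega)

theorem Admissible.det_ne_zero [DecidableEq ι] {M : Matrix ι ι ℝ} {S : Finset ι} (h : Admissible M S) :
    (kktMatrix M S).det ≠ 0 := by
  rcases h with h | h
  · refine kktMatrix_det_ne_zero M (Finset.card_pos.1 (by omega)) fun u hu hne => ?_
    obtain ⟨i, rfl⟩ := Finset.card_eq_one.1 h
    refine absurd (funext fun j => ?_) hne
    have : ∀ k : ({i} : Finset ι), k = j := fun k => Subtype.ext
      ((Finset.mem_singleton.1 k.2).trans (Finset.mem_singleton.1 j.2).symm)
    rwa [Fintype.sum_eq_single j fun k hk => absurd (this k) hk] at hu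
  · exact h.2.1

theorem Admissible.pos [DecidableEq ι] {M : Matrix ι ι ℝ} {S : Finset ι} (h : Admissible M S) (i : S) :
    0 < candidateVector M S i := by
  have hs := (kktSolution_spec h.det_ne_zero).2
  rcases h with h | h
  · obtain ⟨a, rfl⟩ := Finset.card_eq_one.1 h
    have : ∀ k : ({a} : Finset ι), k = i := fun k => Subtype.ext
      ((Finset.mem_singleton.1 k.2).trans (Finset.mem_singleton.1 i.2).symm)
    rw [Fintype.sum_eq_single i fun k hk => absurd (this k) hk] at hs
    rw [hs]; exact one_pos
  · exact h.2.2.1 i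

/-- The support of a vector, as a finset. -/
noncomputable def vecSupport [Fintype ι] (x : ι → ℝ) : Finset ι := Finset.univ.filter fun i => x i ≠ 0

theorem mem_vecSupport [Fintype ι] {x : ι → ℝ} {i : ι} : i ∈ vecSupport x ↔ x i ≠ 0 := by
  simp [vecSupport]

/-- Without ties, every minimizer on a face is the candidate vector of its support, which is
admissible: a flat tangent direction would lead to two minimizers on different smaller faces. -/
theorem IsFaceMin.admissible [Fintype ι] [DecidableEq ι] {M : Matrix ι ι ℝ} (hM : M.IsSymm) {C : Finset ι}
    (hC : NoTie M C) {x : ι → ℝ} (hx : IsFaceMin M C x) :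
    Admissible M (vecSupport x) ∧
      kktSolution M (vecSupport x) = Sum.elim (fun i : vecSupport x => x i) fun _ => x ⬝ᵥ M *ᵥ x := by
  induction hm : (vecSupport x).card using Nat.strong_induction_on generalizing x with
  | _ m ih =>
  subst hm
  have hsub : ∀ {y}, IsFaceMin M C y → vecSupport y ⊆ C := fun {y} hy i hi => by
    by_contra h; exact mem_vecSupport.1 hi (hy.supp i h)
  have hzero : ∀ i, i ∉ vecSupport x → x i = 0 := fun i hi => by
    by_contra h; exact hi (mem_vecSupport.2 h)
  set S := vecSupport x with hS
  have hpd : ∀ u : S → ℝ, ∑ i, u i = 0 → u ≠ 0 → 0 < u ⬝ᵥ principalSub M S *ᵥ u := by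
    intro w hw hw0
    by_contra! hc
    set u := extendVec S w with hu
    have hur : (fun j : S => u j) = w := funext fun j => extendVec_coe S w j
    have huz : ∀ i, i ∉ S → u i = 0 := fun i hi => extendVec_of_notMem S w hi
    rw [← hur, principalSub_quad M S huz] at hc
    have husum : ∑ i, u i = 0 := by
      rw [← sum_coe_eq_sum S huz, ← hw]
      exact Finset.sum_congr rfl fun i _ => extendVec_coe S w i
    have hune : u ≠ 0 := by
      intro h; apply hw0; rw [← hur, h]; rfl
    have hux : ∀ i, x i = 0 → u i = 0 := fun i hi => huz i fun h => mem_vecSupport.1 h hi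
    obtain ⟨y, hy, hyx, ⟨i, hi, hyi⟩, -⟩ := hx.exists_boundary hM hux husum hune hc
    obtain ⟨z, hz, hzx, ⟨j, hj, hzj⟩, hzpos⟩ := hx.exists_boundary hM (u := -u)
      (fun i hi => by simp [hux i hi]) (by simp [husum]) (neg_ne_zero.2 hune)
      (by simpa [mulVec_neg] using hc)
    have hlt : ∀ {y : ι → ℝ}, (∀ i, x i = 0 → y i = 0) → ∀ i, x i ≠ 0 → y i = 0 →
        (vecSupport y).card < S.card := fun {y} hyx i hi hyi =>
      Finset.card_lt_card ⟨fun k hk => mem_vecSupport.2 fun h => mem_vecSupport.1 hk (hyx k h),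
        fun h => mem_vecSupport.1 (h (mem_vecSupport.2 hi)) hyi⟩
    have hxi : x i ≠ 0 := fun h => hi.ne (hux i h)
    have hxj : x j ≠ 0 := fun h => hj.ne (by simp [hux j h])
    obtain ⟨ay, ky⟩ := ih _ (hlt hyx i hxi hyi) hy rfl
    obtain ⟨az, kz⟩ := ih _ (hlt hzx j hxj hzj) hz rfl
    refine hC _ _ (hsub hy) (hsub hz) (fun h => ?_) ay az ?_
    · have : i ∈ vecSupport z := mem_vecSupport.2 (hzpos i (by simpa using hi))
      rw [← h] at this
      exact mem_vecSupport.1 this hyi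
    · rw [candidateValue, candidateValue, ky, kz]
      exact le_antisymm (hy.le z hz.mem hz.supp) (hz.le y hy.mem hy.supp)
  have hne : S.Nonempty := by
    by_contra h
    rw [Finset.not_nonempty_iff_eq_empty] at h
    have := hx.mem.2
    rw [Finset.sum_eq_zero fun i _ => hzero i (by simp [h])] at this
    exact zero_ne_one this
  have hdet := kktMatrix_det_ne_zero M hne hpd
  have hk := kktSolution_eq hdet (w := fun i => x i) (s := x ⬝ᵥ M *ᵥ x)
    (fun i => by
      rw [principalSub_mulVec M S hzero i]; exact hx.mulVec_eq hM (mem_vecSupport.1 i.2))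
    (by rw [sum_coe_eq_sum S hzero]; exact hx.mem.2)
  refine ⟨?_, hk⟩
  rcases (Nat.succ_le_of_lt (Finset.card_pos.2 hne)).eq_or_lt with h1 | h1
  · exact Or.inl h1.symm
  · refine Or.inr ⟨h1, hdet, fun i => ?_, hpd⟩
    rw [candidateVector, hk]
    change 0 < x i
    exact lt_of_le_of_ne (hx.mem.1 i) (Ne.symm (mem_vecSupport.1 i.2))

theorem IsFaceMin.unique [Fintype ι] [DecidableEq ι] {M : Matrix ι ι ℝ} (hM : M.IsSymm) {C : Finset ι} (hC : NoTie M C)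
    {x y : ι → ℝ} (hx : IsFaceMin M C x) (hy : IsFaceMin M C y) : x = y := by
  obtain ⟨ax, kx⟩ := hx.admissible hM hC
  obtain ⟨ay, ky⟩ := hy.admissible hM hC
  have hsub : ∀ {y}, IsFaceMin M C y → vecSupport y ⊆ C := fun {y} hy i hi => by
    by_contra h; exact mem_vecSupport.1 hi (hy.supp i h)
  have hS : vecSupport x = vecSupport y := by
    by_contra h
    refine hC _ _ (hsub hx) (hsub hy) h ax ay ?_
    rw [candidateValue, candidateValue, kx, ky]
    exact le_antisymm (hx.le y hy.mem hy.supp) (hy.le x hx.mem hx.supp)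
  have key : ∀ S : Finset ι, vecSupport x = S → vecSupport y = S → ∀ i, x i = y i := by
    rintro S rfl hS i
    rw [hS] at ky
    by_cases hi : i ∈ vecSupport x
    · have := congrFun (kx.symm.trans ky) (.inl ⟨i, hi⟩)
      simpa using this
    · have h1 : x i = 0 := by by_contra h; exact hi (mem_vecSupport.2 h)
      have h2 : y i = 0 := by by_contra h; exact hi (hS ▸ mem_vecSupport.2 h)
      rw [h1, h2]
  exact funext (key _ rfl hS.symm)

end Support

/-! ### Local relaxations -/

section Local

variable {ι : Type*}

theorem IsDNN.sum_nonneg [Fintype ι] {Y : Matrix ι ι ℝ} (hY : IsDNN Y) : 0 ≤ ∑ i, ∑ j, Y i j :=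
  Finset.sum_nonneg fun i _ => Finset.sum_nonneg fun j _ => hY.2 i j

theorem IsDNN.eq_zero_of_sum_eq_zero [Fintype ι] {Y : Matrix ι ι ℝ} (hY : IsDNN Y)
    (h : ∑ i, ∑ j, Y i j = 0) : Y = 0 := by
  ext i j
  have h1 := (Finset.sum_eq_zero_iff_of_nonneg fun i _ =>
    Finset.sum_nonneg fun j _ => hY.2 i j).1 h i (Finset.mem_univ i)
  exact (Finset.sum_eq_zero_iff_of_nonneg fun j _ => hY.2 i j).1 h1 j (Finset.mem_univ j)

/-- Homogeneous form of the DNN lower bound. -/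
theorem IsDNN.dnnValue_mul_sum_le [Fintype ι] (Z : Matrix ι ι ℝ) {W : Matrix ι ι ℝ}
    (hW : IsDNN W) : dnnValue Z * ∑ i, ∑ j, W i j ≤ matInner Z W := by
  rcases hW.sum_nonneg.eq_or_lt with h | h
  · rw [hW.eq_zero_of_sum_eq_zero h.symm]
    simp [matInner]
  · have hne : Nonempty ι := by
      by_contra hn
      rw [not_nonempty_iff] at hn
      simp at h
    set σ := ∑ i, ∑ j, W i j with hσ
    have hmem : σ⁻¹ • W ∈ dnnFeasible ι := by
      refine ⟨?_, hW.1.smul (inv_nonneg.2 h.le), fun i j =>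
        mul_nonneg (inv_nonneg.2 h.le) (hW.2 i j)⟩
      rw [matInner_smul, matInner_ones, ← hσ, inv_mul_cancel₀ h.ne']
    have h1 := (dnnValue_isLeast Z).2 ⟨_, hmem, rfl⟩
    rw [matInner_smul, inv_mul_eq_div, le_div_iff₀ h] at h1
    exact h1

theorem dnnValue_le_quad [Fintype ι] [Nonempty ι] (Z : Matrix ι ι ℝ) {x : ι → ℝ}
    (hx : x ∈ stdSimplex ℝ ι) : dnnValue Z ≤ x ⬝ᵥ Z *ᵥ x :=
  (dnnValue_isLeast Z).2 ⟨_, vecMulVec_mem_dnnFeasible hx, matInner_vecMulVec Z x⟩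

theorem dnnValue_le_diag [Fintype ι] (Z : Matrix ι ι ℝ) (i : ι) : dnnValue Z ≤ Z i i := by
  classical
  have : Nonempty ι := ⟨i⟩
  simpa using dnnValue_le_quad Z (single_mem_stdSimplex ℝ i)

/-- Exactness of the DNN relaxation in order at most four. -/
theorem dnnValue_eq_stqpValue [Fintype ι] [Nonempty ι] (hcard : Fintype.card ι ≤ 4)
    (Z : Matrix ι ι ℝ) : dnnValue Z = stqpValue Z := by
  apply le_antisymm
  · obtain ⟨x, hx, he⟩ := (stqpValue_isLeast Z).1
    rw [← he]
    exact dnnValue_le_quad Z hx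
  · obtain ⟨Y, hY, he⟩ := (dnnValue_isLeast Z).1
    have hcp : Y ∈ cpCone ι := IsDNN.mem_cpCone (s := Finset.univ) ⟨hY.2.1, hY.2.2⟩ hcard (by simp)
    have h := (mem_cpCone_le_matInner (v := stqpValue Z)
      (fun x hx => (stqpValue_isLeast Z).2 ⟨x, hx, rfl⟩) hcp).1
    have h1 := hY.1
    rw [matInner_ones] at h1
    rwa [h1, mul_one, he] at h

theorem mem_stdSimplex_coe_iff [Fintype ι] {S : Finset ι} {u : ι → ℝ}
    (hu : ∀ i, i ∉ S → u i = 0) :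
    (fun i : S => u i) ∈ stdSimplex ℝ S ↔ u ∈ stdSimplex ℝ ι := by
  refine ⟨fun h => ⟨fun i => ?_, ?_⟩, fun h => ⟨fun i => h.1 i, ?_⟩⟩
  · by_cases hi : i ∈ S
    · exact h.1 ⟨i, hi⟩
    · exact (hu i hi).ge
  · rw [← sum_coe_eq_sum S hu]; exact h.2
  · rw [sum_coe_eq_sum S hu]; exact h.2

theorem IsFaceMin.stqpValue_eq [Fintype ι] {M : Matrix ι ι ℝ} {S : Finset ι} {x : ι → ℝ}
    (hx : IsFaceMin M S x) : stqpValue (principalSub M S) = x ⬝ᵥ M *ᵥ x := by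
  classical
  have hmem := (mem_stdSimplex_coe_iff hx.supp).2 hx.mem
  have hl : IsLeast ((fun y : S → ℝ => y ⬝ᵥ principalSub M S *ᵥ y) '' stdSimplex ℝ S)
      (x ⬝ᵥ M *ᵥ x) := by
    refine ⟨⟨_, hmem, principalSub_quad M S hx.supp⟩, ?_⟩
    rintro _ ⟨y, hy, rfl⟩
    have hr : (fun j : S => extendVec S y j) = y := funext fun j => extendVec_coe S y j
    have hz : ∀ i, i ∉ S → extendVec S y i = 0 := fun i hi => extendVec_of_notMem S y hi
    have h := hx.le (extendVec S y) ((mem_stdSimplex_coe_iff hz).1 (by rwa [hr])) hz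
    rwa [← principalSub_quad M S hz, hr] at h
  exact hl.csInf_eq

/-- Extension of a matrix by zero. -/
def extendMat [DecidableEq ι] (S : Finset ι) (Y : Matrix S S ℝ) : Matrix ι ι ℝ :=
  fun i j => if h : i ∈ S ∧ j ∈ S then Y ⟨i, h.1⟩ ⟨j, h.2⟩ else 0

theorem extendMat_coe [DecidableEq ι] (S : Finset ι) (Y : Matrix S S ℝ) (i j : S) :
    extendMat S Y i j = Y i j := by
  simp [extendMat]

theorem extendMat_left [DecidableEq ι] (S : Finset ι) (Y : Matrix S S ℝ) {i : ι} (hi : i ∉ S)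
    (j : ι) : extendMat S Y i j = 0 := by
  simp [extendMat, hi]

theorem extendMat_right [DecidableEq ι] (S : Finset ι) (Y : Matrix S S ℝ) (i : ι) {j : ι}
    (hj : j ∉ S) : extendMat S Y i j = 0 := by
  simp [extendMat, hj]

theorem sum_sum_mul_extendMat [Fintype ι] [DecidableEq ι] (S : Finset ι) (Y : Matrix S S ℝ)
    (f : ι → ι → ℝ) :
    ∑ i, ∑ j, f i j * extendMat S Y i j = ∑ i : S, ∑ j : S, f i j * Y i j := by
  rw [← sum_coe_eq_sum S fun i hi => by simp [extendMat_left S Y hi]]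
  refine Finset.sum_congr rfl fun i _ => ?_
  rw [← sum_coe_eq_sum S fun j hj => by simp [extendMat_right S Y _ hj]]
  exact Finset.sum_congr rfl fun j _ => by rw [extendMat_coe]

theorem extendMat_mem_dnnFeasible [Fintype ι] [DecidableEq ι] {S : Finset ι} {Y : Matrix S S ℝ}
    (hY : Y ∈ dnnFeasible S) : extendMat S Y ∈ dnnFeasible ι := by
  refine ⟨?_, posSemidef_iff_dotProduct_mulVec.2 ⟨?_, fun x => ?_⟩, fun i j => ?_⟩
  · have h := sum_sum_mul_extendMat S Y fun _ _ => 1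
    have h1 := hY.1
    rw [matInner_ones] at h1 ⊢
    simpa only [one_mul, h1] using h
  · ext i j
    simp only [conjTranspose_apply, star_trivial, extendMat]
    by_cases hi : i ∈ S <;> by_cases hj : j ∈ S <;> simp [hi, hj]
    exact hY.2.1.apply_comm _ _
  · have h := (posSemidef_iff_dotProduct_mulVec.1 hY.2.1).2 fun i => x i
    have e := sum_sum_mul_extendMat S Y fun i j => x i * x j
    simp only [star_trivial, dotProduct, mulVec, Finset.mul_sum] at h ⊢
    calc 0 ≤ ∑ i : S, ∑ j : S, x i * (Y i j * x j) := h
      _ = ∑ i : S, ∑ j : S, x i * x j * Y i j :=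
        Finset.sum_congr rfl fun i _ => Finset.sum_congr rfl fun j _ => by ring
      _ = ∑ i, ∑ j, x i * x j * extendMat S Y i j := e.symm
      _ = _ := Finset.sum_congr rfl fun i _ => Finset.sum_congr rfl fun j _ => by ring
  · simp only [extendMat]
    split_ifs
    exacts [hY.2.2 _ _, le_rfl]

theorem dnnValue_le_principalSub [Fintype ι] (M : Matrix ι ι ℝ) {S : Finset ι}
    (hS : S.Nonempty) : dnnValue M ≤ dnnValue (principalSub M S) := by
  classical
  have : Nonempty S := hS.to_subtype
  obtain ⟨i, -⟩ := hS
  have : Nonempty ι := ⟨i⟩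
  obtain ⟨Y, hY, he⟩ := (dnnValue_isLeast (principalSub M S)).1
  rw [← he]
  refine (dnnValue_isLeast M).2 ⟨_, extendMat_mem_dnnFeasible hY, ?_⟩
  exact sum_sum_mul_extendMat S Y M

end Local

/-! ### Decomposition along blocks with nonnegative coupling -/

section Decomposition

variable {ι κ : Type*} [Fintype ι] [Fintype κ]

/-- The mass of `Y` on the principal block `S`. -/
def blockMass (Y : Matrix ι ι ℝ) (S : Finset ι) : ℝ := ∑ i : S, ∑ j : S, principalSub Y S i j

theorem IsDNN.principalSub {ι : Type*} {Y : Matrix ι ι ℝ} (hY : IsDNN Y) (S : Finset ι) :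
    IsDNN (principalSub Y S) :=
  ⟨hY.1.submatrix _, fun i j => hY.2 i j⟩

theorem sum_blocks {f : ι → κ} {C : κ → Finset ι} (hC : ∀ i k, i ∈ C k ↔ f i = k)
    (g : ι → ι → ℝ) (hg : ∀ i j, f i ≠ f j → 0 ≤ g i j) :
    ∑ k, ∑ i : C k, ∑ j : C k, g i j ≤ ∑ i, ∑ j, g i j := by
  classical
  have hC' : ∀ k, C k = Finset.univ.filter fun i => f i = k := fun k => by
    ext i; simp [hC]
  calc ∑ k, ∑ i : C k, ∑ j : C k, g i j
      = ∑ k, ∑ i ∈ C k, ∑ j ∈ C k, g i j := by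
        refine Finset.sum_congr rfl fun k _ => ?_
        rw [Finset.sum_coe_sort (C k) fun i => ∑ j : C k, g i j]
        exact Finset.sum_congr rfl fun i _ => Finset.sum_coe_sort (C k) fun j => g i j
    _ = ∑ k, ∑ i ∈ C k, ∑ j ∈ C (f i), g i j := by
        refine Finset.sum_congr rfl fun k _ => Finset.sum_congr rfl fun i hi => ?_
        rw [(hC i k).1 hi]
    _ = ∑ i, ∑ j ∈ C (f i), g i j := by
        simp_rw [hC' _]
        exact Finset.sum_fiberwise Finset.univ f fun i => ∑ j with f j = f i, g i j
    _ ≤ ∑ i, ∑ j, g i j := by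
        refine Finset.sum_le_sum fun i _ => ?_
        refine Finset.sum_le_sum_of_subset_of_nonneg (Finset.subset_univ _) fun j _ hj => ?_
        exact hg i j fun h => hj ((hC j (f i)).2 h.symm)

theorem sum_dnnValue_mul_blockMass_le {M Y : Matrix ι ι ℝ} {f : ι → κ} {C : κ → Finset ι}
    (hC : ∀ i k, i ∈ C k ↔ f i = k) (hM : ∀ i j, f i ≠ f j → 0 ≤ M i j) (hY : IsDNN Y) :
    ∑ k, dnnValue (principalSub M (C k)) * blockMass Y (C k) ≤ matInner M Y := by
  refine le_trans (Finset.sum_le_sum fun k _ => ?_)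
    (sum_blocks hC (fun i j => M i j * Y i j) fun i j hij => mul_nonneg (hM i j hij) (hY.2 i j))
  exact (hY.principalSub (C k)).dnnValue_mul_sum_le _

theorem sum_blockMass_le_one {Y : Matrix ι ι ℝ} {f : ι → κ} {C : κ → Finset ι}
    (hC : ∀ i k, i ∈ C k ↔ f i = k) (hY : Y ∈ dnnFeasible ι) :
    ∑ k, blockMass Y (C k) ≤ 1 := by
  have h := hY.1
  rw [matInner_ones] at h
  rw [← h]
  exact sum_blocks hC Y fun i j _ => hY.2.2 i j

/-- For a nonpositive lower bound `v` of the local values, the excess of a feasible point over `v`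
controls its mass on every block. -/
theorem excess_blockMass_le {M Y : Matrix ι ι ℝ} {f : ι → κ} {C : κ → Finset ι}
    (hC : ∀ i k, i ∈ C k ↔ f i = k) (hM : ∀ i j, f i ≠ f j → 0 ≤ M i j) {v : ℝ} (hv : v ≤ 0)
    (hvk : ∀ k, v ≤ dnnValue (principalSub M (C k))) (hY : Y ∈ dnnFeasible ι) (k : κ) :
    v + (dnnValue (principalSub M (C k)) - v) * blockMass Y (C k) ≤ matInner M Y := by
  have hD : IsDNN Y := ⟨hY.2.1, hY.2.2⟩
  have h1 := sum_dnnValue_mul_blockMass_le hC hM hD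
  have h2 := sum_blockMass_le_one hC hY
  have h3 : (dnnValue (principalSub M (C k)) - v) * blockMass Y (C k) ≤
      ∑ k, (dnnValue (principalSub M (C k)) - v) * blockMass Y (C k) :=
    Finset.single_le_sum (f := fun k => (dnnValue (principalSub M (C k)) - v) * blockMass Y (C k))
      (fun l _ => mul_nonneg (sub_nonneg.2 (hvk l)) (hD.principalSub (C l)).sum_nonneg)
      (Finset.mem_univ k)
  simp only [sub_mul, Finset.sum_sub_distrib, ← Finset.mul_sum] at h3
  have h4 : v * 1 ≤ v * ∑ k, blockMass Y (C k) := mul_le_mul_of_nonpos_left h2 hv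
  linarith

theorem dnnValue_isLeast_blocks {M : Matrix ι ι ℝ} {f : ι → κ} {C : κ → Finset ι}
    (hC : ∀ i k, i ∈ C k ↔ f i = k) (hf : f.Surjective) (hM : ∀ i j, f i ≠ f j → 0 ≤ M i j)
    (hd : ∃ i, M i i ≤ 0) :
    IsLeast (Set.range fun k => dnnValue (principalSub M (C k))) (dnnValue M) := by
  obtain ⟨i₀, hi₀⟩ := hd
  have : Nonempty ι := ⟨i₀⟩
  have : Nonempty κ := ⟨f i₀⟩
  have hne : ∀ k, (C k).Nonempty := fun k => by
    obtain ⟨i, hi⟩ := hf k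
    exact ⟨i, (hC i k).2 hi⟩
  have hle : ∀ k, dnnValue M ≤ dnnValue (principalSub M (C k)) := fun k =>
    dnnValue_le_principalSub M (hne k)
  obtain ⟨k, hk⟩ := Finite.exists_min fun k => dnnValue (principalSub M (C k))
  have hv : dnnValue (principalSub M (C k)) ≤ 0 :=
    ((hk (f i₀)).trans (dnnValue_le_diag (principalSub M (C (f i₀))) ⟨i₀, (hC i₀ _).2 rfl⟩)).trans hi₀
  refine ⟨⟨k, le_antisymm ?_ (hle k)⟩, by rintro _ ⟨k, rfl⟩; exact hle k⟩
  obtain ⟨Y, hY, he⟩ := (dnnValue_isLeast M).1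
  have h := excess_blockMass_le hC hM hv hk hY k
  rwa [sub_self, zero_mul, add_zero, he] at h

theorem rank_vecMulVec_self [DecidableEq ι] {x : ι → ℝ} (hx : x ≠ 0) :
    (vecMulVec x x).rank = 1 := by
  refine le_antisymm (rank_vecMulVec_le x x) (Nat.one_le_iff_ne_zero.2 fun h => hx ?_)
  have hb : LinearMap.range (vecMulVec x x).mulVecLin = ⊥ := Submodule.finrank_eq_zero.1 h
  have h0 : vecMulVec x x *ᵥ x = 0 := by
    have := LinearMap.congr_fun (LinearMap.range_eq_bot.1 hb) x
    simpa using this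
  ext i
  have h1 := congrFun h0 i
  simp only [vecMulVec_mulVec, Pi.smul_apply, MulOpposite.smul_eq_mul_unop, MulOpposite.unop_op,
    Pi.zero_apply, mul_eq_zero, dotProduct_self_eq_zero] at h1
  rcases h1 with h1 | h1
  · exact h1
  · rw [h1]

/-- Distinct local values concentrate every optimizer on one block; if that block has order at most
four and its candidate values do not tie, the optimizer is unique and has rank one. -/
theorem hasUniqueRankOneOptimizer_of_blocks [DecidableEq ι] {M : Matrix ι ι ℝ} {f : ι → κ}
    {C : κ → Finset ι} (hsymm : M.IsSymm)
    (hC : ∀ i k, i ∈ C k ↔ f i = k) (hf : f.Surjective) (hM : ∀ i j, f i ≠ f j → 0 ≤ M i j)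
    (hd : ∃ i, M i i ≤ 0) (hinj : Function.Injective fun k => dnnValue (principalSub M (C k)))
    (hcard : ∀ k, (C k).card ≤ 4) (hnt : ∀ k, NoTie M (C k)) :
    HasUniqueRankOneOptimizer M := by
  obtain ⟨⟨k, hk⟩, hmin⟩ := dnnValue_isLeast_blocks hC hf hM hd
  simp only at hk
  obtain ⟨i₀, hi₀⟩ := hd
  have : Nonempty ι := ⟨i₀⟩
  have hv : dnnValue M ≤ 0 := (dnnValue_le_diag M i₀).trans hi₀
  have hne : (C k).Nonempty := by
    obtain ⟨i, hi⟩ := hf k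
    exact ⟨i, (hC i k).2 hi⟩
  have hopt : ∀ Y, IsDNNOptimizer M Y → matInner M Y = dnnValue M := fun Y hY => by
    obtain ⟨W, hW, he⟩ := (dnnValue_isLeast M).1
    exact le_antisymm (he ▸ hY.2 W hW) ((dnnValue_isLeast M).2 ⟨Y, hY.1, rfl⟩)
  have hopt' : ∀ Y ∈ dnnFeasible ι, matInner M Y = dnnValue M → IsDNNOptimizer M Y :=
    fun Y hY he => ⟨hY, fun W hW => he ▸ (dnnValue_isLeast M).2 ⟨W, hW, rfl⟩⟩
  -- an optimizer has no mass on the blocks other than `C k`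
  have hsupp : ∀ Y, IsDNNOptimizer M Y → ∀ i, i ∉ C k → Y i i = 0 := by
    intro Y hY i hi
    have hD : IsDNN Y := ⟨hY.1.2.1, hY.1.2.2⟩
    have h := excess_blockMass_le hC hM hv (fun l => hmin ⟨l, rfl⟩) hY.1 (f i)
    rw [hopt Y hY] at h
    have hlt : dnnValue M < dnnValue (principalSub M (C (f i))) := by
      refine lt_of_le_of_ne (hmin ⟨f i, rfl⟩) fun he => hi ((hC i k).2 ?_)
      exact (hinj (hk.trans he)).symm
    have h0 := (hD.principalSub (C (f i))).sum_nonneg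
    have hz : blockMass Y (C (f i)) = 0 := by
      refine le_antisymm ?_ h0
      by_contra! hp
      have := mul_pos (sub_pos.2 hlt) hp
      linarith
    have := (hD.principalSub (C (f i))).eq_zero_of_sum_eq_zero hz
    exact congrFun (congrFun this ⟨i, (hC i _).2 rfl⟩) ⟨i, (hC i _).2 rfl⟩
  obtain ⟨x, hx⟩ := exists_isFaceMin M hne
  have hxv : x ⬝ᵥ M *ᵥ x = dnnValue M := by
    have : Nonempty (C k) := hne.to_subtype
    rw [← hx.stqpValue_eq, ← hk]
    exact (dnnValue_eq_stqpValue (by simpa using hcard k) _).symm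
  have huniq : ∀ y ∈ stdSimplex ℝ ι, y ⬝ᵥ M *ᵥ y = dnnValue M → y = x := by
    intro y hy hyv
    have ho := hopt' _ (vecMulVec_mem_dnnFeasible hy) (by rw [matInner_vecMulVec, hyv])
    have hyf : IsFaceMin M (C k) y := by
      refine ⟨hy, fun i hi => ?_, fun z hz _ => hyv ▸ dnnValue_le_quad M hz⟩
      simpa [vecMulVec_apply] using hsupp _ ho i hi
    exact hyf.unique hsymm (hnt k) hx
  refine ⟨vecMulVec x x, hopt' _ (vecMulVec_mem_dnnFeasible hx.mem)
    (by rw [matInner_vecMulVec, hxv]), rank_vecMulVec_self ?_, fun Y hY => ?_⟩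
  · rintro rfl
    simpa using hx.mem.2
  · have hcp : Y ∈ cpCone ι :=
      IsDNN.mem_cpCone ⟨hY.1.2.1, hY.1.2.2⟩ (hcard k) (hsupp Y hY)
    have h1 := hY.1.1
    rw [matInner_ones] at h1
    have := (mem_cpCone_le_matInner (fun z hz => dnnValue_le_quad M hz) hcp).2 x huniq
      (by rw [h1, mul_one, hopt Y hY])
    rwa [h1, one_smul] at this

/-- The minimum over each block is the candidate value of an admissible set, so local values do not
tie either. -/
theorem injective_dnnValue_of_noTie {κ : Type*} [DecidableEq ι] {M : Matrix ι ι ℝ} {f : ι → κ}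
    {C : κ → Finset ι} (hsymm : M.IsSymm)
    (hC : ∀ i k, i ∈ C k ↔ f i = k) (hf : f.Surjective)
    (hcard : ∀ k, (C k).card ≤ 4)
    (hnt : ∀ S T : Finset ι, (∃ k, S ⊆ C k) → (∃ k, T ⊆ C k) → S ≠ T → Admissible M S →
      Admissible M T → candidateValue M S ≠ candidateValue M T) :
    Function.Injective fun k => dnnValue (principalSub M (C k)) := by
  have key : ∀ k, ∃ S ⊆ C k, Admissible M S ∧
      candidateValue M S = dnnValue (principalSub M (C k)) := fun k => by
    have hne : (C k).Nonempty := by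
      obtain ⟨i, hi⟩ := hf k
      exact ⟨i, (hC i k).2 hi⟩
    have : Nonempty (C k) := hne.to_subtype
    obtain ⟨x, hx⟩ := exists_isFaceMin M hne
    obtain ⟨hadm, hsol⟩ := hx.admissible hsymm
      fun S T hS hT => hnt S T ⟨k, hS⟩ ⟨k, hT⟩
    refine ⟨vecSupport x, fun i hi => ?_, hadm, ?_⟩
    · by_contra h
      exact mem_vecSupport.1 hi (hx.supp i h)
    · rw [dnnValue_eq_stqpValue (by simpa using hcard k), hx.stqpValue_eq, candidateValue, hsol]
      rfl
  intro k l hkl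
  obtain ⟨S, hS, hSa, hSv⟩ := key k
  obtain ⟨T, hT, hTa, hTv⟩ := key l
  by_contra hne
  refine hnt S T ⟨k, hS⟩ ⟨l, hT⟩ ?_ hSa hTa (hSv.trans (Eq.trans hkl hTv.symm))
  rintro rfl
  obtain ⟨i, hi⟩ := hSa.nonempty
  exact hne (((hC i k).1 (hS hi)).symm.trans ((hC i l).1 (hT hi)))

end Decomposition

/-! ### Candidate values under a shift and under a change of one diagonal entry -/

section CandidateValues

variable {ι : Type*} [DecidableEq ι]

theorem principalSub_sub_smul_mulVec {ι : Type*} (A : Matrix ι ι ℝ) (m : ℝ) (S : Finset ι) (u : S → ℝ) (i : S) :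
    (principalSub (A - m • Matrix.of fun _ _ => (1 : ℝ)) S *ᵥ u) i =
      (principalSub A S *ᵥ u) i - m * ∑ j, u j := by
  simp [principalSub, mulVec, dotProduct, sub_mul, Finset.sum_sub_distrib, Finset.mul_sum]

theorem kktMatrix_det_ne_zero_of_shift {A : Matrix ι ι ℝ} {m : ℝ} {S : Finset ι}
    (h : (kktMatrix (A - m • Matrix.of fun _ _ => (1 : ℝ)) S).det ≠ 0) :
    (kktMatrix A S).det ≠ 0 := by
  intro hdet
  obtain ⟨w, hw, hw0⟩ := exists_mulVec_eq_zero_iff.2 hdet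
  refine h (exists_mulVec_eq_zero_iff.1 ⟨w, hw, ?_⟩)
  obtain ⟨u, s, rfl⟩ : ∃ (u : S → ℝ) (s : ℝ), w = Sum.elim u fun _ => s :=
    ⟨fun i => w (.inl i), w (.inr ()), by ext (i | i) <;> rfl⟩
  rw [kktMatrix_mulVec] at hw0 ⊢
  have h2 : ∑ i, u i = 0 := congrFun hw0 (.inr ())
  rw [← hw0]
  congr 1
  ext i
  rw [principalSub_sub_smul_mulVec, h2, mul_zero, sub_zero]

/-- Subtracting `m E` keeps the candidate vector and lowers the candidate value by `m`. -/
theorem kktSolution_shift {A : Matrix ι ι ℝ} {m : ℝ} {S : Finset ι}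
    (h : (kktMatrix (A - m • Matrix.of fun _ _ => (1 : ℝ)) S).det ≠ 0) :
    kktSolution (A - m • Matrix.of fun _ _ => (1 : ℝ)) S =
      Sum.elim (candidateVector A S) fun _ => candidateValue A S - m := by
  obtain ⟨h1, h2⟩ := kktSolution_spec (kktMatrix_det_ne_zero_of_shift h)
  refine kktSolution_eq h (fun i => ?_) h2
  rw [principalSub_sub_smul_mulVec, h1, h2, mul_one]

/-- `S` and `T` have equal candidate values, where `S` has an invertible bordered matrix and a
positive candidate vector. The latter conditions are imposed on `S` only. -/
def Tie (A : Matrix ι ι ℝ) (S T : Finset ι) : Prop :=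
  (kktMatrix A S).det ≠ 0 ∧ (∀ i, 0 < candidateVector A S i) ∧
    candidateValue A S = candidateValue A T

theorem Admissible.tie_of_shift {A : Matrix ι ι ℝ} {m : ℝ} {S T : Finset ι}
    (hS : Admissible (A - m • Matrix.of fun _ _ => (1 : ℝ)) S)
    (hT : Admissible (A - m • Matrix.of fun _ _ => (1 : ℝ)) T)
    (h : candidateValue (A - m • Matrix.of fun _ _ => (1 : ℝ)) S =
      candidateValue (A - m • Matrix.of fun _ _ => (1 : ℝ)) T) : Tie A S T := by
  have eS := kktSolution_shift hS.det_ne_zero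
  have eT := kktSolution_shift hT.det_ne_zero
  refine ⟨kktMatrix_det_ne_zero_of_shift hS.det_ne_zero, fun i => ?_, ?_⟩
  · have := hS.pos i
    rwa [candidateVector, eS] at this
  · rw [candidateValue, candidateValue, eS, eT] at h
    simpa using h

/-- The candidate value of `S` is strictly monotone in a diagonal entry `A i i` with `i ∈ S`, as
long as the candidate vector is positive, while that of `T` does not depend on it if `i ∉ T`. -/
theorem Tie.diag_eq {A B : Matrix ι ι ℝ} (hA : A.IsSymm) {S T : Finset ι} {i : ι} (hi : i ∈ S)
    (hiT : i ∉ T) (hAB : ∀ a b, (a ≠ i ∨ b ≠ i) → A a b = B a b) (h1 : Tie A S T)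
    (h2 : Tie B S T) : A i i = B i i := by
  have hT : kktMatrix A T = kktMatrix B T := by
    have : principalSub A T = principalSub B T := by
      ext a b
      refine hAB a b (Or.inl ?_)
      rintro h
      exact hiT (h ▸ a.2)
    rw [kktMatrix, kktMatrix, this]
  have hc : candidateValue A S = candidateValue B S := by
    rw [h1.2.2, h2.2.2, candidateValue, candidateValue, kktSolution, kktSolution, hT]
  obtain ⟨a1, a2⟩ := kktSolution_spec h1.1
  obtain ⟨b1, b2⟩ := kktSolution_spec h2.1
  set x := candidateVector A S
  set y := candidateVector B S
  set j : S := ⟨i, hi⟩ with hj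
  have hBA : principalSub B S = principalSub A S + Matrix.single j j (B i i - A i i) := by
    ext a b
    simp only [principalSub, submatrix_apply, Matrix.add_apply, Matrix.single_apply]
    split_ifs with h
    · rw [← h.1, ← h.2]; simp [hj]
    · rw [add_zero]
      refine (hAB a b ?_).symm
      by_contra! h'
      exact h ⟨Subtype.ext h'.1.symm, Subtype.ext h'.2.symm⟩
  have e1 : x ⬝ᵥ principalSub B S *ᵥ y = candidateValue A S := by
    simp only [dotProduct, b1, ← Finset.sum_mul, a2, one_mul, hc]
  have e2 : x ⬝ᵥ principalSub A S *ᵥ y = candidateValue A S := by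
    have hs : (principalSub A S)ᵀ = principalSub A S := by
      rw [principalSub, transpose_submatrix, hA.eq]
    rw [dotProduct_mulVec, ← mulVec_transpose, hs]
    simp only [dotProduct, a1, ← Finset.mul_sum, b2, mul_one]
  have e3 : x ⬝ᵥ Matrix.single j j (B i i - A i i) *ᵥ y = (B i i - A i i) * (x j * y j) := by
    rw [Matrix.single_mulVec, dotProduct, Finset.sum_eq_single j]
    · simp; ring
    · intro b _ hb; simp [hb]
    · simp
  rw [hBA, add_mulVec, dotProduct_add, e2, e3] at e1
  have h0 : (B i i - A i i) * (x j * y j) = 0 := by linarith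
  rcases mul_eq_zero.1 h0 with h | h
  · linarith
  · exact absurd h (mul_pos (h1.2.1 j) (h2.2.1 j)).ne'

end CandidateValues

/-! ### Product measures and one-coordinate integration -/

section ProductMeasure

variable {I : Type*} [Fintype I] [DecidableEq I] (ν : I → Measure ℝ)
  [∀ p, IsProbabilityMeasure (ν p)]

theorem lintegral_pi_eq_lintegral_update {f : (I → ℝ) → ENNReal} (hf : Measurable f) (p : I) :
    ∫⁻ x, f x ∂Measure.pi ν = ∫⁻ x, ∫⁻ t, f (Function.update x p t) ∂ν p ∂Measure.pi ν := by
  have hun : (Finset.univ : Finset I) = Finset.univ.erase p ∪ {p} := by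
    ext a; by_cases h : a = p <;> simp [h]
  have hd : Disjoint (Finset.univ.erase p) {p} := by simp
  have hg : Measurable (∫⋯∫⁻_{p}, f ∂ν) := hf.lmarginal ν
  have hgg : ∫⋯∫⁻_{p}, (∫⋯∫⁻_{p}, f ∂ν) ∂ν = ∫⋯∫⁻_{p}, f ∂ν := by
    ext x
    simp [lmarginal_singleton]
  have e : ∀ x, ∫⁻ t, f (Function.update x p t) ∂ν p = (∫⋯∫⁻_{p}, f ∂ν) x := fun x => by
    rw [lmarginal_singleton]
  simp_rw [e]
  rw [lintegral_eq_lmarginal_univ 0, lintegral_eq_lmarginal_univ 0, hun,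
    lmarginal_union ν f hf hd, lmarginal_union ν _ hg hd, hgg]

theorem pi_eq_zero_of_section_subsingleton {B : Set (I → ℝ)} (hB : MeasurableSet B) (p : I)
    [NullSingletonClass (ν p)] (h : ∀ x, {t | Function.update x p t ∈ B}.Subsingleton) :
    Measure.pi ν B = 0 := by
  rw [← lintegral_indicator_one hB,
    lintegral_pi_eq_lintegral_update ν (measurable_one.indicator hB) p]
  refine lintegral_eq_zero_of_ae_eq_zero (ae_of_all _ fun x => ?_)
  have hm : MeasurableSet {t | Function.update x p t ∈ B} := measurable_update x hB
  have e : (fun t => B.indicator (1 : (I → ℝ) → ENNReal) (Function.update x p t)) =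
      {t | Function.update x p t ∈ B}.indicator 1 := by
    ext t; rfl
  change ∫⁻ t, B.indicator (1 : (I → ℝ) → ENNReal) (Function.update x p t) ∂ν p = 0
  rw [e, lintegral_indicator_one hm, (h x).measure_zero]

/-- Conditionally on `m x`, which does not depend on the coordinates in `T`, the events
`x e ≤ m x` for `e ∈ T` are independent, with probability `F (m x)` each. -/
theorem lintegral_prod_ite_le {m : (I → ℝ) → ℝ} (hm : Measurable m) {F : ℝ → ENNReal}
    (hF : Measurable F) {T : Finset I} (hT : ∀ e ∈ T, ∀ x t, m (Function.update x e t) = m x)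
    (hν : ∀ e ∈ T, ∀ s, ν e (Set.Iic s) = F s) (k : ℕ) :
    ∫⁻ x, (∏ e ∈ T, if x e ≤ m x then 1 else 0) * F (m x) ^ k ∂Measure.pi ν =
      ∫⁻ x, F (m x) ^ (k + T.card) ∂Measure.pi ν := by
  induction T using Finset.induction_on generalizing k with
  | empty => simp
  | insert e T he ih =>
    have hmeas : Measurable fun x : I → ℝ =>
        (∏ e ∈ insert e T, if x e ≤ m x then (1 : ENNReal) else 0) * F (m x) ^ k := by
      refine Measurable.mul (Finset.measurable_fun_prod _ fun a _ => ?_) ((hF.comp hm).pow_const k)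
      exact Measurable.ite (measurableSet_le (measurable_pi_apply a) hm) measurable_const
        measurable_const
    rw [lintegral_pi_eq_lintegral_update ν hmeas e, Finset.card_insert_of_notMem he,
      show k + (T.card + 1) = (k + 1) + T.card by ring,
      ← ih (fun a ha => hT a (Finset.mem_insert_of_mem ha))
        (fun a ha => hν a (Finset.mem_insert_of_mem ha))]
    refine lintegral_congr fun x => ?_
    have h1 : ∀ t, ((∏ a ∈ insert e T, if Function.update x e t a ≤ m (Function.update x e t) then
        (1 : ENNReal) else 0) * F (m (Function.update x e t)) ^ k) =
        (Set.Iic (m x)).indicator 1 t *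
          ((∏ a ∈ T, if x a ≤ m x then (1 : ENNReal) else 0) * F (m x) ^ k) := fun t => by
      rw [hT e (Finset.mem_insert_self e T), Finset.prod_insert he, mul_assoc]
      congr 1
      · simp [Set.indicator_apply]
      · congr 1
        refine Finset.prod_congr rfl fun a ha => ?_
        have : a ≠ e := by rintro rfl; exact he ha
        rw [Function.update_of_ne this]
    simp_rw [h1]
    rw [lintegral_mul_const _ (measurable_one.indicator measurableSet_Iic),
      lintegral_indicator_one measurableSet_Iic, hν e (Finset.mem_insert_self e T)]
    ring

theorem pi_forall_le {m : (I → ℝ) → ℝ} (hm : Measurable m) {F : ℝ → ENNReal}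
    (hF : Measurable F) {T : Finset I} (hT : ∀ e ∈ T, ∀ x t, m (Function.update x e t) = m x)
    (hν : ∀ e ∈ T, ∀ s, ν e (Set.Iic s) = F s) :
    Measure.pi ν {x | ∀ e ∈ T, x e ≤ m x} = ∫⁻ x, F (m x) ^ T.card ∂Measure.pi ν := by
  have h := lintegral_prod_ite_le ν hm hF hT hν 0
  have hms : MeasurableSet {x : I → ℝ | ∀ e ∈ T, x e ≤ m x} := by
    simp only [Set.ofPred_forall]
    exact MeasurableSet.iInter fun e => MeasurableSet.iInter fun _ =>
      measurableSet_le (measurable_pi_apply e) hm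
  rw [zero_add] at h
  rw [← h, ← lintegral_indicator_one hms]
  refine lintegral_congr fun x => ?_
  rw [pow_zero, mul_one, Finset.prod_ite_zero]
  simp [Set.indicator_apply]

end ProductMeasure

/-! ### The random symmetric matrix -/

section RandomMatrix

variable {n : ℕ}

/-- Index set of the entries on and above the diagonal. -/
abbrev UpperIdx (n : ℕ) : Type := {p : Fin n × Fin n // p.1 ≤ p.2}

/-- The unordered pair `{a, b}` as an index on or above the diagonal. -/
def pairIdx (a b : Fin n) : UpperIdx n := ⟨(min a b, max a b), min_le_max⟩

/-- The symmetric matrix with prescribed entries on and above the diagonal. -/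
def ofUpper (x : UpperIdx n → ℝ) : Matrix (Fin n) (Fin n) ℝ := fun a b => x (pairIdx a b)

theorem pairIdx_comm (a b : Fin n) : pairIdx a b = pairIdx b a := by
  simp [pairIdx, min_comm, max_comm]

theorem pairIdx_eq_iff {a b c d : Fin n} :
    pairIdx a b = pairIdx c d ↔ (a = c ∧ b = d) ∨ (a = d ∧ b = c) := by
  simp only [pairIdx, Subtype.mk.injEq, Prod.mk.injEq]
  grind

theorem isSymm_ofUpper (x : UpperIdx n → ℝ) : (ofUpper x).IsSymm := by
  ext a b
  simp [ofUpper, pairIdx_comm a b]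

theorem ofUpper_eq {A : Matrix (Fin n) (Fin n) ℝ} (hA : A.IsSymm) :
    ofUpper (fun p : UpperIdx n => A p.1.1 p.1.2) = A := by
  ext a b
  rcases le_total a b with h | h
  · simp [ofUpper, pairIdx, h]
  · simp [ofUpper, pairIdx, h, hA.apply]

theorem measurable_kktSolution (S : Finset (Fin n)) (k : S ⊕ Unit) :
    Measurable fun x : UpperIdx n → ℝ => kktSolution (ofUpper x) S k := by
  have hK : Continuous fun x : UpperIdx n → ℝ => kktMatrix (ofUpper x) S := by
    refine Continuous.matrix_fromBlocks ?_ continuous_const continuous_const continuous_const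
    exact continuous_matrix fun a b => continuous_apply _
  simp only [kktSolution, mulVec, dotProduct, Matrix.inv_def, Matrix.smul_apply, smul_eq_mul,
    Ring.inverse_eq_inv']
  refine Finset.measurable_fun_sum _ fun j _ => Measurable.mul_const (Measurable.mul ?_ ?_) _
  · exact hK.matrix_det.measurable.inv
  · exact (hK.matrix_adjugate.matrix_elem k j).measurable

theorem measurableSet_tie (S T : Finset (Fin n)) :
    MeasurableSet {x : UpperIdx n → ℝ | Tie (ofUpper x) S T} := by
  have hK : Continuous fun x : UpperIdx n → ℝ => kktMatrix (ofUpper x) S := by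
    refine Continuous.matrix_fromBlocks ?_ continuous_const continuous_const continuous_const
    exact continuous_matrix fun a b => continuous_apply _
  refine MeasurableSet.inter ?_ (MeasurableSet.inter ?_ ?_)
  · exact (hK.matrix_det.measurable (measurableSet_singleton 0)).compl
  · change MeasurableSet {x : UpperIdx n → ℝ | ∀ i, 0 < candidateVector (ofUpper x) S i}
    simp only [Set.ofPred_forall]
    exact MeasurableSet.iInter fun i =>
      measurableSet_lt measurable_const (measurable_kktSolution S _)
  · exact measurableSet_eq_fun (measurable_kktSolution S _) (measurable_kktSolution T _)

theorem measurable_diagMin :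
    Measurable fun x : UpperIdx n → ℝ => diagMin (ofUpper x) := by
  exact Measurable.iInf fun i => measurable_pi_apply _

theorem diagMin_update {e : UpperIdx n} (he : e.1.1 ≠ e.1.2) (x : UpperIdx n → ℝ) (t : ℝ) :
    diagMin (ofUpper (Function.update x e t)) = diagMin (ofUpper x) := by
  refine iInf_congr fun i => ?_
  have : pairIdx i i ≠ e := by
    rintro rfl
    simp [pairIdx] at he
  simp [ofUpper, Function.update_of_ne this]

variable {Ω : Type*} [MeasurableSpace Ω] {P : Measure Ω} {Q : Ω → Matrix (Fin n) (Fin n) ℝ} {νD νO : Measure ℝ}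

/-- The law of the upper-triangular entry with a given index. -/
def entryLaw (νD νO : Measure ℝ) (p : UpperIdx n) : Measure ℝ :=
  if p.1.1 = p.1.2 then νD else νO

instance [IsProbabilityMeasure νD] [IsProbabilityMeasure νO] (p : UpperIdx n) :
    IsProbabilityMeasure (entryLaw νD νO p) := by
  unfold entryLaw
  split_ifs <;> infer_instance

theorem IsRandomSymm.map_upper [IsProbabilityMeasure P] (hQ : IsRandomSymm P Q νD νO) :
    P.map (fun ω (p : UpperIdx n) => Q ω p.1.1 p.1.2) = Measure.pi (entryLaw νD νO) := by
  rw [(iIndepFun_iff_map_fun_eq_pi_map fun p => (hQ.measurable _ _).aemeasurable).1 hQ.indep]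
  congr 1
  ext1 p
  unfold entryLaw
  split_ifs with h
  · rw [h]; exact hQ.law_diag _
  · exact hQ.law_off _ _ (lt_of_le_of_ne p.2 h)

theorem IsRandomSymm.measurable_upper (hQ : IsRandomSymm P Q νD νO) :
    Measurable fun ω (p : UpperIdx n) => Q ω p.1.1 p.1.2 :=
  measurable_pi_lambda _ fun _ => hQ.measurable _ _

variable [IsProbabilityMeasure P] [IsProbabilityMeasure νD] [IsProbabilityMeasure νO]

theorem IsRandomSymm.ae_not_tie (hQ : IsRandomSymm P Q νD νO) [NullSingletonClass νD] :
    ∀ᵐ ω ∂P, ∀ S T : Finset (Fin n), ∀ i ∈ S, i ∉ T → ¬ Tie (Q ω) S T := by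
  simp only [ae_all_iff]
  intro S T i hi hiT
  have : NullSingletonClass (entryLaw νD νO (pairIdx i i)) := by
    simpa [entryLaw, pairIdx]
  have h0 : Measure.pi (entryLaw νD νO) {x : UpperIdx n → ℝ | Tie (ofUpper x) S T} = 0 := by
    refine pi_eq_zero_of_section_subsingleton _ (measurableSet_tie S T) (pairIdx i i)
      fun x s hs t ht => ?_
    have h := Tie.diag_eq (isSymm_ofUpper _) hi hiT (fun a b hab => ?_) hs ht
    · simpa [ofUpper] using h
    · have : pairIdx a b ≠ pairIdx i i := by
        rw [Ne, pairIdx_eq_iff]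
        tauto
      simp [ofUpper, Function.update_of_ne this]
  rw [← hQ.map_upper, Measure.map_apply hQ.measurable_upper (measurableSet_tie S T)] at h0
  filter_upwards [measure_eq_zero_iff_ae_notMem.1 h0] with ω hω h
  refine hω ?_
  simp only [Set.mem_preimage, Set.mem_ofPred_eq]
  rwa [ofUpper_eq (hQ.symm ω)]

theorem IsRandomSymm.measure_forall_le (hQ : IsRandomSymm P Q νD νO) {T : Finset (UpperIdx n)}
    (hT : ∀ e ∈ T, e.1.1 ≠ e.1.2) :
    P {ω | ∀ e ∈ T, Q ω e.1.1 e.1.2 ≤ diagMin (Q ω)} =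
      ENNReal.ofReal (∫ ω, (cdf νO (diagMin (Q ω))) ^ T.card ∂P) := by
  have hF : Measurable fun s => cdf νO s := (monotone_cdf νO).measurable
  have h := pi_forall_le (entryLaw νD νO) (measurable_diagMin (n := n)) (T := T)
    (F := fun s => ENNReal.ofReal (cdf νO s)) hF.ennreal_ofReal
    (fun e he x t => diagMin_update (hT e he) x t)
    (fun e he s => by rw [entryLaw, if_neg (hT e he), ofReal_cdf])
  have hms : MeasurableSet {x : UpperIdx n → ℝ | ∀ e ∈ T, x e ≤ diagMin (ofUpper x)} := by
    simp only [Set.ofPred_forall]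
    exact MeasurableSet.iInter fun e => MeasurableSet.iInter fun _ =>
      measurableSet_le (measurable_pi_apply e) measurable_diagMin
  have hm : Measurable fun ω => diagMin (Q ω) := Measurable.iInf fun i => hQ.measurable i i
  have hg : Measurable fun x : UpperIdx n → ℝ =>
      ENNReal.ofReal (cdf νO (diagMin (ofUpper x))) ^ T.card :=
    (hF.ennreal_ofReal.comp measurable_diagMin).pow_const _
  rw [← hQ.map_upper, Measure.map_apply hQ.measurable_upper hms,
    lintegral_map hg hQ.measurable_upper] at h
  have hi : Integrable (fun ω => (cdf νO (diagMin (Q ω))) ^ T.card) P := by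
    refine Integrable.of_bound ((hF.comp hm).pow_const _).aestronglyMeasurable 1
      (ae_of_all _ fun ω => ?_)
    rw [Real.norm_of_nonneg (pow_nonneg (cdf_nonneg νO _) _)]
    exact pow_le_one₀ (cdf_nonneg νO _) (cdf_le_one νO _)
  rw [ofReal_integral_eq_lintegral_ofReal hi
    (ae_of_all _ fun ω => pow_nonneg (cdf_nonneg νO _) _)]
  simp only [Set.preimage_ofPred_eq, ofUpper_eq (hQ.symm _)] at h
  rw [h]
  exact lintegral_congr fun ω => (ENNReal.ofReal_pow (cdf_nonneg νO _) _).symm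

end RandomMatrix

/-! ### The defect graph -/

section DefectGraph

variable {n : ℕ} {A : Matrix (Fin n) (Fin n) ℝ}

theorem shifted_apply (A : Matrix (Fin n) (Fin n) ℝ) (i j : Fin n) :
    shifted A i j = A i j - diagMin A := by
  simp [shifted]

theorem isSymm_shifted (hA : A.IsSymm) : (shifted A).IsSymm := by
  ext i j
  simp [shifted_apply, hA.apply]

theorem defectGraph_adj (hA : A.IsSymm) {i j : Fin n} :
    (defectGraph A).Adj i j ↔ i ≠ j ∧ shifted A i j < 0 := by
  simp only [defectGraph, SimpleGraph.fromRel_adj]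
  have := (isSymm_shifted hA).apply i j
  refine and_congr_right fun hne => ⟨?_, fun h => ?_⟩
  · rintro (⟨-, h⟩ | ⟨-, h⟩)
    · exact h
    · rwa [← this]
  · rcases lt_or_gt_of_ne hne with h' | h'
    · exact Or.inl ⟨h', h⟩
    · exact Or.inr ⟨h', by rwa [this]⟩

theorem mem_compVerts {G : SimpleGraph (Fin n)} {C : G.ConnectedComponent} {i : Fin n} :
    i ∈ compVerts C ↔ G.connectedComponentMk i = C := by
  simp [compVerts, SimpleGraph.ConnectedComponent.mem_supp_iff]

theorem shifted_nonneg_of_ne (hA : A.IsSymm) {i j : Fin n}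
    (h : (defectGraph A).connectedComponentMk i ≠ (defectGraph A).connectedComponentMk j) :
    0 ≤ shifted A i j := by
  by_contra! hlt
  refine h (SimpleGraph.ConnectedComponent.eq.2 (SimpleGraph.Adj.reachable ?_))
  exact (defectGraph_adj hA).2 ⟨fun e => h (by rw [e]), hlt⟩

theorem exists_shifted_diag_nonpos (hn : 0 < n) (A : Matrix (Fin n) (Fin n) ℝ) :
    ∃ i, shifted A i i ≤ 0 := by
  have : Nonempty (Fin n) := ⟨⟨0, hn⟩⟩
  obtain ⟨i, hi⟩ := exists_eq_ciInf_of_finite (f := fun i => A i i)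
  exact ⟨i, by rw [shifted_apply, diagMin, ← hi, sub_self]⟩

theorem connectedComponentMk_surjective {G : SimpleGraph (Fin n)} :
    Function.Surjective G.connectedComponentMk := fun C =>
  C.ind fun v => ⟨v, rfl⟩

/-- A component with at least `k` vertices contains a tree on `k` vertices, listed so that every
vertex but the first is adjacent to an earlier one. -/
theorem exists_growing_tree {G : SimpleGraph (Fin n)} (C : G.ConnectedComponent) {k : ℕ}
    (hk : k + 1 ≤ (compVerts C).card) :
    ∃ v : ℕ → Fin n, Set.InjOn v (Set.Iic k) ∧ (∀ i ≤ k, v i ∈ compVerts C) ∧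
      ∀ i < k, ∃ j ≤ i, G.Adj (v j) (v (i + 1)) := by
  induction k with
  | zero =>
    obtain ⟨a, ha⟩ := Finset.card_pos.1 (Nat.lt_of_lt_of_le Nat.zero_lt_one hk)
    refine ⟨fun _ => a, fun i hi j hj _ => ?_, fun _ _ => ha, fun i hi => absurd hi (by simp)⟩
    rw [Set.mem_Iic, Nat.le_zero] at hi hj
    rw [hi, hj]
  | succ k ih =>
    obtain ⟨v, hinj, hmem, hadj⟩ := ih (by omega)
    have hcard : ((Finset.range (k + 1)).image v).card < (compVerts C).card :=
      lt_of_le_of_lt Finset.card_image_le (by rw [Finset.card_range]; omega)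
    obtain ⟨u, huC, hu⟩ := Finset.exists_mem_notMem_of_card_lt_card hcard
    have hreach : G.Reachable (v 0) u := by
      rw [← SimpleGraph.ConnectedComponent.eq, mem_compVerts.1 (hmem 0 (by omega)),
        mem_compVerts.1 huC]
    obtain ⟨p⟩ := hreach
    obtain ⟨d, -, hd1, hd2⟩ := p.exists_boundary_dart (((Finset.range (k + 1)).image v : Finset _))
      (by simpa using ⟨0, by omega, rfl⟩) (by simpa using hu)
    simp only [Finset.coe_image, Finset.coe_range, Set.mem_image, Set.mem_Iio] at hd1 hd2
    obtain ⟨j, hj, hjd⟩ := hd1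
    have hv : ∀ i ≤ k, Function.update v (k + 1) d.toProd.2 i = v i := fun i hi =>
      Function.update_of_ne (by omega) _ _
    have hnew : ∀ i ≤ k, v i ≠ d.toProd.2 := fun i hi he => hd2 ⟨i, by omega, he⟩
    refine ⟨Function.update v (k + 1) d.toProd.2, fun a ha b hb hab => ?_, fun i hi => ?_,
      fun i hi => ?_⟩
    · rw [Set.mem_Iic] at ha hb
      rcases Nat.le_succ_iff.1 ha with ha' | rfl <;> rcases Nat.le_succ_iff.1 hb with hb' | rfl
      · rw [hv a ha', hv b hb'] at hab
        exact hinj ha' hb' hab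
      · rw [hv a ha', Function.update_self] at hab
        exact absurd hab (hnew a ha')
      · rw [hv b hb', Function.update_self] at hab
        exact absurd hab.symm (hnew b hb')
      · rfl
    · rcases Nat.le_succ_iff.1 hi with hi' | rfl
      · rw [hv i hi']; exact hmem i hi'
      · rw [Function.update_self, mem_compVerts, ← mem_compVerts.1 (hmem j (by omega)), hjd]
        exact (SimpleGraph.ConnectedComponent.eq.2 d.adj.reachable).symm
    · rcases (Nat.lt_succ_iff.1 hi).lt_or_eq with hi' | rfl
      · obtain ⟨l, hl, hla⟩ := hadj i hi'
        exact ⟨l, hl, by rwa [hv l (by omega), hv (i + 1) (by omega)]⟩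
      · exact ⟨j, by omega, by rw [hv j (by omega), Function.update_self, hjd]; exact d.adj⟩

/-- The set of edges of the tree on the vertices `v` in which `v (i + 1)` is attached to
`v (p i)`. -/
def treeEdges (v : Fin 5 → Fin n) (p : Fin 4 → Fin 5) : Finset (UpperIdx n) :=
  Finset.univ.image fun i => pairIdx (v (p i)) (v i.succ)

theorem card_treeEdges {v : Fin 5 → Fin n} (hv : Function.Injective v) {p : Fin 4 → Fin 5}
    (hp : ∀ i, p i ≤ i.castSucc) : (treeEdges v p).card = 4 := by
  rw [treeEdges, Finset.card_image_of_injective, Finset.card_univ, Fintype.card_fin]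
  intro i j hij
  have hi := hp i
  have hj := hp j
  simp only [pairIdx_eq_iff, hv.eq_iff] at hij
  rcases hij with ⟨-, h⟩ | ⟨h1, h2⟩
  · exact Fin.succ_injective _ h
  · rw [h1] at hi
    rw [← h2] at hj
    simp only [Fin.le_def, Fin.val_succ, Fin.val_castSucc] at hi hj
    omega

theorem treeEdges_offDiag {v : Fin 5 → Fin n} (hv : Function.Injective v) {p : Fin 4 → Fin 5}
    (hp : ∀ i, p i ≤ i.castSucc) {e : UpperIdx n} (he : e ∈ treeEdges v p) : e.1.1 ≠ e.1.2 := by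
  simp only [treeEdges, Finset.mem_image, Finset.mem_univ, true_and] at he
  obtain ⟨i, rfl⟩ := he
  have hi := hp i
  intro h
  rw [hv (inf_eq_sup.1 h)] at hi
  simp only [Fin.le_def, Fin.val_succ, Fin.val_castSucc] at hi
  omega

theorem exists_treeEdges_of_not_smallComponents (hA : A.IsSymm) (h : ¬ SmallComponents A) :
    ∃ (v : Fin 5 → Fin n) (p : Fin 4 → Fin 5), Function.Injective v ∧ (∀ i, p i ≤ i.castSucc) ∧
      ∀ e ∈ treeEdges v p, A e.1.1 e.1.2 ≤ diagMin A := by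
  simp only [SmallComponents, not_forall, not_le] at h
  obtain ⟨C, hC⟩ := h
  obtain ⟨v, hinj, -, hadj⟩ := exists_growing_tree C (k := 4) hC
  choose! p hp hpa using hadj
  refine ⟨fun i => v i, fun i => ⟨p i, by have := hp i i.2; omega⟩, fun i j hij => ?_,
    fun i => hp i i.2, fun e he => ?_⟩
  · exact Fin.ext (hinj (Set.mem_Iic.2 (by omega)) (Set.mem_Iic.2 (by omega)) hij)
  · simp only [treeEdges, Finset.mem_image, Finset.mem_univ, true_and] at he
    obtain ⟨i, rfl⟩ := he
    have h1 := ((defectGraph_adj hA).1 (hpa i i.2)).2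
    rw [shifted_apply] at h1
    have h2 : A (pairIdx (v (p i)) (v (i + 1))).1.1 (pairIdx (v (p i)) (v (i + 1))).1.2 =
        A (v (p i)) (v (i + 1)) := congrFun (congrFun (ofUpper_eq hA) (v (p i))) (v (i + 1))
    change A (pairIdx (v (p i)) (v (i + 1))).1.1 (pairIdx (v (p i)) (v (i + 1))).1.2 ≤ _
    rw [h2]
    linarith

/-- Union bound over labelled trees with five vertices. -/
theorem IsRandomSymm.measure_not_smallComponents_le {Ω : Type*} [MeasurableSpace Ω]
    {P : Measure Ω} [IsProbabilityMeasure P] {Q : Ω → Matrix (Fin n) (Fin n) ℝ}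
    {νD νO : Measure ℝ} [IsProbabilityMeasure νD] [IsProbabilityMeasure νO]
    (hQ : IsRandomSymm P Q νD νO) :
    P {ω | ¬ SmallComponents (Q ω)} ≤
      ENNReal.ofReal (625 * ((n : ℝ) ^ 5 * ∫ ω, (cdf νO (diagMin (Q ω))) ^ 4 ∂P)) := by
  set c := ENNReal.ofReal (∫ ω, (cdf νO (diagMin (Q ω))) ^ 4 ∂P) with hc
  have hsub : {ω | ¬ SmallComponents (Q ω)} ⊆
      ⋃ v : Fin 5 → Fin n, ⋃ p : Fin 4 → Fin 5, {ω | (Function.Injective v ∧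
        ∀ i, p i ≤ i.castSucc) ∧ ∀ e ∈ treeEdges v p, Q ω e.1.1 e.1.2 ≤ diagMin (Q ω)} := by
    intro ω hω
    obtain ⟨v, p, hv, hp, h⟩ := exists_treeEdges_of_not_smallComponents (hQ.symm ω) hω
    exact Set.mem_iUnion₂.2 ⟨v, p, ⟨hv, hp⟩, h⟩
  have hle : ∀ (v : Fin 5 → Fin n) (p : Fin 4 → Fin 5), P {ω | (Function.Injective v ∧
        ∀ i, p i ≤ i.castSucc) ∧ ∀ e ∈ treeEdges v p, Q ω e.1.1 e.1.2 ≤ diagMin (Q ω)} ≤ c := by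
    intro v p
    by_cases h : Function.Injective v ∧ ∀ i, p i ≤ i.castSucc
    · have := hQ.measure_forall_le fun e he => treeEdges_offDiag h.1 h.2 he
      rw [card_treeEdges h.1 h.2, ← hc] at this
      exact (measure_mono fun ω hω => hω.2).trans this.le
    · simp [h]
  calc P {ω | ¬ SmallComponents (Q ω)}
      ≤ ∑ v : Fin 5 → Fin n, ∑ p : Fin 4 → Fin 5, c :=
        (measure_mono hsub).trans <| (measure_iUnion_fintype_le _ _).trans <|
          Finset.sum_le_sum fun v _ => (measure_iUnion_fintype_le _ _).trans <|
            Finset.sum_le_sum fun p _ => hle v p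
    _ = ENNReal.ofReal (625 * ((n : ℝ) ^ 5 * ∫ ω, (cdf νO (diagMin (Q ω))) ^ 4 ∂P)) := by
        rw [ENNReal.ofReal_mul (by norm_num), ENNReal.ofReal_mul (by positivity), ← hc]
        simp only [Finset.sum_const, Finset.card_univ, Fintype.card_pi, Fintype.card_fin,
          Finset.prod_const, nsmul_eq_mul]
        rw [ENNReal.ofReal_pow (by positivity), ENNReal.ofReal_natCast]
        norm_num
        ring

theorem hasUniqueRankOneOptimizer_of_shifted (h : HasUniqueRankOneOptimizer (shifted A)) :
    HasUniqueRankOneOptimizer A := by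
  have key : ∀ X ∈ dnnFeasible (Fin n), matInner A X = matInner (shifted A) X + diagMin A := by
    intro X hX
    have h1 := hX.1
    rw [matInner_ones] at h1
    simp only [matInner, shifted_apply, sub_mul, Finset.sum_sub_distrib, ← Finset.mul_sum, h1]
    ring
  have hiff : ∀ X, IsDNNOptimizer A X ↔ IsDNNOptimizer (shifted A) X := fun X => by
    refine and_congr_right fun hX => forall₂_congr fun Y hY => ?_
    rw [key X hX, key Y hY, add_le_add_iff_right]
  obtain ⟨X, hX, hr, hu⟩ := h
  exact ⟨X, (hiff X).2 hX, hr, fun Y hY => hu Y ((hiff Y).1 hY)⟩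

end DefectGraph

theorem theorem1 {Ω : ℕ → Type*} [∀ n, MeasurableSpace (Ω n)]
    (P : (n : ℕ) → Measure (Ω n)) [∀ n, IsProbabilityMeasure (P n)]
    (Q : (n : ℕ) → Ω n → Matrix (Fin n) (Fin n) ℝ)
    (νD νO : Measure ℝ) [IsProbabilityMeasure νD] [IsProbabilityMeasure νO]
    (hQ : ∀ n, IsRandomSymm (P n) (Q n) νD νO)
    (hD : νD ≪ volume) (hO : νO ≪ volume)
    (htail : Tendsto (fun n : ℕ => (n : ℝ) ^ 5 * ∫ ω, (cdf νO (diagMin (Q n ω))) ^ 4 ∂(P n))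
      atTop (𝓝 0)) :
    -- the DNN optimizer is unique and rank one with probability tending to one
    Tendsto (fun n => P n {ω | HasUniqueRankOneOptimizer (Q n ω)}) atTop (𝓝 1) ∧
    -- all defect components have size at most four with probability tending to one
    Tendsto (fun n => P n {ω | SmallComponents (Q n ω)}) atTop (𝓝 1) ∧
    -- on that event: decomposition of the shifted value, and exactness of the local relaxations
    (∀ n, 0 < n → ∀ ω, SmallComponents (Q n ω) →
      IsLeast (Set.range fun C : (defectGraph (Q n ω)).ConnectedComponent =>
        dnnValue (principalSub (shifted (Q n ω)) (compVerts C))) (dnnValue (shifted (Q n ω))) ∧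
      ∀ C : (defectGraph (Q n ω)).ConnectedComponent,
        dnnValue (principalSub (shifted (Q n ω)) (compVerts C)) =
          stqpValue (principalSub (shifted (Q n ω)) (compVerts C))) ∧
    -- almost surely on that event: no ties between local candidates or between local values,
    -- and the optimizer of the DNN program and of its shifted form is unique and rank one
    (∀ n, 0 < n → ∀ᵐ ω ∂(P n), SmallComponents (Q n ω) →
      (∀ S T : Finset (Fin n), InsideComponent (Q n ω) S → InsideComponent (Q n ω) T →
        S ≠ T → Admissible (shifted (Q n ω)) S → Admissible (shifted (Q n ω)) T →
        candidateValue (shifted (Q n ω)) S ≠ candidateValue (shifted (Q n ω)) T) ∧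
      (Function.Injective fun C : (defectGraph (Q n ω)).ConnectedComponent =>
        dnnValue (principalSub (shifted (Q n ω)) (compVerts C))) ∧
      HasUniqueRankOneOptimizer (shifted (Q n ω)) ∧ HasUniqueRankOneOptimizer (Q n ω)) := by
  have hNA : NullSingletonClass νD := ⟨fun a => hD (measure_singleton a)⟩
  have hlocal : ∀ n, 0 < n → ∀ᵐ ω ∂(P n), SmallComponents (Q n ω) →
      (∀ S T : Finset (Fin n), InsideComponent (Q n ω) S → InsideComponent (Q n ω) T →
        S ≠ T → Admissible (shifted (Q n ω)) S → Admissible (shifted (Q n ω)) T →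
        candidateValue (shifted (Q n ω)) S ≠ candidateValue (shifted (Q n ω)) T) ∧
      (Function.Injective fun C : (defectGraph (Q n ω)).ConnectedComponent =>
        dnnValue (principalSub (shifted (Q n ω)) (compVerts C))) ∧
      HasUniqueRankOneOptimizer (shifted (Q n ω)) ∧ HasUniqueRankOneOptimizer (Q n ω) := by
    intro n hn
    filter_upwards [(hQ n).ae_not_tie] with ω hω hsmall
    have hsymm := (hQ n).symm ω
    have := Fintype.ofFinite (defectGraph (Q n ω)).ConnectedComponent
    have hnt : ∀ S T : Finset (Fin n), S ≠ T → Admissible (shifted (Q n ω)) S →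
        Admissible (shifted (Q n ω)) T →
        candidateValue (shifted (Q n ω)) S ≠ candidateValue (shifted (Q n ω)) T := by
      intro S T hne hS hT he
      by_cases hST : S ⊆ T
      · obtain ⟨i, hiT, hiS⟩ := Finset.exists_of_ssubset (hST.ssubset_of_ne hne)
        exact hω T S i hiT hiS (Admissible.tie_of_shift hT hS he.symm)
      · obtain ⟨i, hiS, hiT⟩ := Finset.not_subset.1 hST
        exact hω S T i hiS hiT (Admissible.tie_of_shift hS hT he)
    have hinj : Function.Injective fun C : (defectGraph (Q n ω)).ConnectedComponent =>
        dnnValue (principalSub (shifted (Q n ω)) (compVerts C)) :=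
      injective_dnnValue_of_noTie (isSymm_shifted hsymm) (fun i C => mem_compVerts)
        connectedComponentMk_surjective hsmall fun S T _ _ => hnt S T
    have huniq : HasUniqueRankOneOptimizer (shifted (Q n ω)) :=
      hasUniqueRankOneOptimizer_of_blocks (isSymm_shifted hsymm) (fun i C => mem_compVerts)
        connectedComponentMk_surjective (fun i j => shifted_nonneg_of_ne hsymm)
        (exists_shifted_diag_nonpos hn _) hinj hsmall fun C S T _ _ => hnt S T
    exact ⟨fun S T _ _ => hnt S T, hinj, huniq, hasUniqueRankOneOptimizer_of_shifted huniq⟩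
  have hsmall : Tendsto (fun n => P n {ω | SmallComponents (Q n ω)}) atTop (𝓝 1) := by
    have h0 : Tendsto (fun n => P n {ω | ¬ SmallComponents (Q n ω)}) atTop (𝓝 0) := by
      have h1 := ENNReal.tendsto_ofReal (htail.const_mul 625)
      rw [mul_zero, ENNReal.ofReal_zero] at h1
      exact tendsto_of_tendsto_of_tendsto_of_le_of_le tendsto_const_nhds h1
        (fun _ => zero_le) fun n => (hQ n).measure_not_smallComponents_le
    have h2 : Tendsto (fun n => 1 - P n {ω | ¬ SmallComponents (Q n ω)}) atTop (𝓝 1) := by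
      simpa using ENNReal.Tendsto.sub (tendsto_const_nhds (x := (1 : ENNReal))) h0
        (Or.inl ENNReal.one_ne_top)
    refine tendsto_of_tendsto_of_tendsto_of_le_of_le h2 tendsto_const_nhds (fun n => ?_)
      fun n => prob_le_one
    -- the event is not known to be measurable, so subadditivity replaces complementation
    rw [tsub_le_iff_right, ← measure_univ (μ := P n)]
    refine le_trans (measure_mono fun ω _ => ?_) (measure_union_le _ _)
    exact em (SmallComponents (Q n ω))
  refine ⟨?_, hsmall, fun n hn ω hω => ?_, hlocal⟩
  · refine tendsto_of_tendsto_of_tendsto_of_le_of_le' hsmall tendsto_const_nhds ?_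
      (Eventually.of_forall fun n => prob_le_one)
    filter_upwards [eventually_gt_atTop 0] with n hn
    refine measure_mono_ae ?_
    filter_upwards [hlocal n hn] with ω hω h
    exact (hω h).2.2.2
  · have := Fintype.ofFinite (defectGraph (Q n ω)).ConnectedComponent
    refine ⟨dnnValue_isLeast_blocks (fun i C => mem_compVerts) connectedComponentMk_surjective
      (fun i j => shifted_nonneg_of_ne ((hQ n).symm ω)) (exists_shifted_diag_nonpos hn _),
      fun C => ?_⟩
    obtain ⟨i, hi⟩ := connectedComponentMk_surjective C
    have : Nonempty (compVerts C) := ⟨⟨i, mem_compVerts.2 hi⟩⟩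
    exact dnnValue_eq_stqpValue (by simpa using hω C) _
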